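/- **Setting.** Let $q\ge 1$ be an integer, $\mathbb Z_q=\{i\in\mathbb Z: -\tfrac q2\le i<\tfrac q2\}$, and let $a \bmod q\in\mathbb Z_q$ denote the centred residue of $a$ (entrywise for vectors and matrices). For $S\subseteq\mathbb Z$ let $\mathcal N_S(\mu,\tau^2)$ be the distribution on $S$ with probabilities proportional to $e^{-(x-\mu)^2/(2\tau^2)}$, $x\in S$. For a lattice $\mathbb L\subseteq\mathbb Z^l$, the smoothing parameter $\eta_\epsilon(\mathbb L)$ is the infimum of all $t>0$ with $\sum_{y\in\mathbb L^*\setminus\{0\}}e^{-\pi t^2\|y\|_2^2}\le\epsilon$, where $\mathbb L^*$ is the dual lattice, that is, the set of all vectors in the real span of $\mathbb L$ that have an integer inner product with every vector of $\mathbb L$. The statistical distance of two distributions on $\mathbb Z$ with probabilities $p,p'$ is $\frac12\sum_x|p(x)-p'(x)|$. The stacked encrypted residual is the LWE ciphertext $$\rho^e=\bigl(P^\rho,\;P^\rho s+r\rho+e^\rho\bigr)\bmod q,\qquad e^\rho=T_c e,$$ with secret vector $s\in\mathbb Z^v$, public matrix $P^\rho\in\mathbb Z^{n\times v}$, plaintext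 residual $\rho\in\mathbb Z^n$, integer scaling $r>0$, and the integer matrix $T_c\in\mathbb Z^{n\times n'}$ of the linear operations that the controller performs on the freshly encrypted signals. The entries of $e=(e_1,\dots,e_{n'})$ are the errors of the fresh encryptions; they are independent with law $\mathcal N_{\mathbb Z_q}(0,\sigma^2)$, $\sigma>0$, while all other data are fixed. Put $\Sigma_p=\sigma^2T_cT_c^\top$. Let $d\in\mathbb Z^n$ be a filtering vector, $d^\top P^\rho\equiv 0 \pmod q$, and suppose that the entries of $T_c^\top d$ have greatest common divisor $1$. **Statement.** For every $K$ there is a constant $C$, depending only on $K$, such that the following holds for all such data, every $0<\epsilon<1$ and every non-zero lattice $\mathbb L\subseteq\mathbb Z^l$ (for instance $\mathbb L=\mathbb Z$). If $$\|T_c^\top d\|_2^2\,\eta_\epsilon(\mathbb L)^2\le\sigma^2$$ and the filtered message overflows the message space only with small probability, $$\Pr\bigl(r\,d^\top\rho+d^\top e^\rho\notin\mathbb Z_q\bigr)\le K\epsilon,$$ then the filtered residual satisfies $d^\top\rho^e\bmod q=(0,X)$, where the law of $X$ is within statistical distance $C\epsilon$ of $\mathcal N_{\mathbb Z_q}\bigl(r\,d^\top\rho,\;d^\top\Sigma_p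 d\bigr)$. -/

import Mathlib

open MeasureTheory ProbabilityTheory

noncomputable section

/-- `ℤ_q`, the set of integers `i` with `-q/2 ≤ i < q/2`. -/
def ZqSet (q : ℕ) : Set ℤ := {i : ℤ | -(q : ℝ) / 2 ≤ (i : ℝ) ∧ (i : ℝ) < (q : ℝ) / 2}

/-- The centred reduction `a mod q = a - ⌊(a + q/2)/q⌋ q`, with values in `ℤ_q` for `q > 0`. -/
def cmod (a : ℤ) (q : ℕ) : ℤ := a - ⌊((a : ℝ) + (q : ℝ) / 2) / (q : ℝ)⌋ * (q : ℤ)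

theorem cmod_mem (a : ℤ) {q : ℕ} (hq : 0 < q) : cmod a q ∈ ZqSet q := by
  have hq' : (0 : ℝ) < q := by exact_mod_cast hq
  have h1 := Int.floor_le (((a : ℝ) + (q : ℝ) / 2) / (q : ℝ))
  have h2 := Int.lt_floor_add_one (((a : ℝ) + (q : ℝ) / 2) / (q : ℝ))
  rw [le_div_iff₀ hq'] at h1
  rw [div_lt_iff₀ hq'] at h2
  simp only [ZqSet, cmod, Set.mem_ofPred_eq]
  push_cast
  constructor <;> linarith

theorem dvd_sub_cmod (a : ℤ) (q : ℕ) : (q : ℤ) ∣ a - cmod a q := by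
  unfold cmod
  exact ⟨⌊((a : ℝ) + (q : ℝ) / 2) / (q : ℝ)⌋, by ring⟩

theorem cmod_eq_of_dvd {a b : ℤ} {q : ℕ} (h : (q : ℤ) ∣ a - b) : cmod a q = cmod b q := by
  obtain ⟨k, hk⟩ := h
  obtain rfl : a = b + q * k := by linarith
  rcases Nat.eq_zero_or_pos q with rfl | hq
  · simp [cmod]
  · have hq' : (q : ℝ) ≠ 0 := by positivity
    have h1 : (((b + (q : ℤ) * k : ℤ) : ℝ) + (q : ℝ) / 2) / (q : ℝ)
        = ((b : ℝ) + (q : ℝ) / 2) / (q : ℝ) + (k : ℝ) := by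
      push_cast
      field_simp
      ring
    unfold cmod
    rw [h1, Int.floor_add_intCast]
    ring

/-- The probability mass function of the discrete normal distribution `N_S(μ, var)` with support
`S ⊆ ℤ`: proportional to `exp (-(x - μ)² / (2 var))` on `S`, and zero off `S`. -/
def discreteNormal (S : Set ℤ) (μ var : ℝ) (x : ℤ) : ℝ :=
  S.indicator (fun x : ℤ => Real.exp (-((x : ℝ) - μ) ^ 2 / (2 * var))) x /
    ∑' y : S, Real.exp (-(((y : ℤ) : ℝ) - μ) ^ 2 / (2 * var))

/-- The probability mass function of an integer-valued random variable. -/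
def massFunction {Ω : Type*} [MeasurableSpace Ω] (P : Measure Ω) (X : Ω → ℤ) (x : ℤ) : ℝ :=
  P.real {ω | X ω = x}

/-- Statistical (total variation) distance of two distributions on `ℤ`, given by their mass
functions. -/
def statDist (p p' : ℤ → ℝ) : ℝ := (1 / 2) * ∑' x : ℤ, |p x - p' x|

/-- A vector of integers as a point of Euclidean space. -/
def realVec {l : ℕ} (x : Fin l → ℤ) : EuclideanSpace ℝ (Fin l) :=
  WithLp.toLp 2 (fun i => (x i : ℝ))

/-- The dual lattice of `L ⊆ ℤ^l`: all `y` in the real span of `L` that have an integer inner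
product with every vector of `L`. -/
def dualLattice {l : ℕ} (L : Submodule ℤ (Fin l → ℤ)) : Set (EuclideanSpace ℝ (Fin l)) :=
  {y | y ∈ Submodule.span ℝ (realVec '' (L : Set (Fin l → ℤ))) ∧
    ∀ x ∈ L, ∃ k : ℤ, inner ℝ (realVec x) y = (k : ℝ)}

/-- The smoothing parameter `η_ε(L)`: the smallest `s > 0` such that the sum of
`exp (-π s² ‖y‖²)` over the non-zero vectors `y` of the dual lattice is at most `ε`. -/
def smoothingParameter {l : ℕ} (L : Submodule ℤ (Fin l → ℤ)) (ε : ℝ) : ℝ :=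
  sInf {s : ℝ | 0 < s ∧
    ∑' y : {y : EuclideanSpace ℝ (Fin l) // y ∈ dualLattice L ∧ y ≠ 0},
      ENNReal.ofReal (Real.exp (-Real.pi * s ^ 2 * ‖(y : EuclideanSpace ℝ (Fin l))‖ ^ 2))
        ≤ ENNReal.ofReal ε}

/-- A ciphertext of a message with `n` entries: the public matrix and the masked message. -/
abbrev Ciphertext (n v : ℕ) : Type := Matrix (Fin n) (Fin v) ℤ × (Fin n → ℤ)

/-- The LWE ciphertext `(P, P s + m r + e) mod q` of the message `m` for the secret vector `s`, the
public matrix `P` and the error vector `e`. -/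
def lweEncrypt (q : ℕ) (r : ℤ) {n v : ℕ} (s : Fin v → ℤ) (P : Matrix (Fin n) (Fin v) ℤ)
    (m e : Fin n → ℤ) : Ciphertext n v :=
  (fun k j => cmod (P k j) q, fun k => cmod (P.mulVec s k + m k * r + e k) q)

/-- The homomorphic evaluation `T c mod q` of an integer matrix `T` on a ciphertext `c`. -/
def linearEval (q : ℕ) {n n' v : ℕ} (T : Matrix (Fin n) (Fin n') ℤ) (c : Ciphertext n' v) :
    Ciphertext n v :=
  (fun k j => cmod ((T * c.1) k j) q, fun k => cmod (T.mulVec c.2 k) q)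

/-- Applying an integer matrix `T` to encryptions of `m` with errors `e` gives an encryption of
`T m`, with public matrix `T P` and error vector `T e`. -/
theorem linearEval_lweEncrypt (q : ℕ) (r : ℤ) {n n' v : ℕ} (s : Fin v → ℤ)
    (P : Matrix (Fin n') (Fin v) ℤ) (m e : Fin n' → ℤ) (T : Matrix (Fin n) (Fin n') ℤ) :
    linearEval q T (lweEncrypt q r s P m e)
      = lweEncrypt q r s (T * P) (T.mulVec m) (T.mulVec e) := by
  have key : ∀ (k : Fin n) (f g : Fin n' → ℤ), (∀ i, (q : ℤ) ∣ f i - g i) →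
      (q : ℤ) ∣ ∑ i, T k i * f i - ∑ i, T k i * g i := by
    intro k f g h
    rw [← Finset.sum_sub_distrib]
    refine Finset.dvd_sum fun i _ => ?_
    rw [← mul_sub]
    exact Dvd.dvd.mul_left (h i) _
  have hc : ∀ a : ℤ, (q : ℤ) ∣ cmod a q - a := fun a => by
    rw [← dvd_neg, neg_sub]
    exact dvd_sub_cmod a q
  refine Prod.ext ?_ ?_
  · funext k j
    exact cmod_eq_of_dvd (key k _ _ fun i => hc (P i j))
  · funext k
    refine cmod_eq_of_dvd ?_
    have h := key k _ _ fun i => hc (P.mulVec s i + m i * r + e i)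
    have h2 : (T * P).mulVec s k + T.mulVec m k * r + T.mulVec e k
        = ∑ i, T k i * (P.mulVec s i + m i * r + e i) := by
      rw [← Matrix.mulVec_mulVec]
      simp only [Matrix.mulVec, dotProduct, Finset.sum_mul, mul_add, Finset.sum_add_distrib,
        mul_assoc]
    rw [h2]
    exact h

/-- The filtered ciphertext `dᵀ c mod q`. -/
def filterCiphertext (q : ℕ) {n v : ℕ} (d : Fin n → ℤ) (c : Ciphertext n v) : (Fin v → ℤ) × ℤ :=
  (fun j => cmod (Matrix.vecMul d c.1 j) q, cmod (dotProduct d c.2) q)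

/-- `Ker_q V`: the integer vectors `x` with `V x = 0 mod q`. -/
def kerQ (q : ℕ) {v n : ℕ} (V : Matrix (Fin v) (Fin n) ℤ) : Set (Fin n → ℤ) :=
  {x | ∀ i, cmod (V.mulVec x i) q = 0}

/-- The covariance matrix `Σ_p = σ² T_c T_cᵀ` of the error `T_c e`, for an error vector `e` with
covariance matrix `σ² I`. -/
def residualCovariance {n n' : ℕ} (σ : ℝ) (Tc : Matrix (Fin n) (Fin n') ℤ) :
    Matrix (Fin n) (Fin n) ℝ :=
  σ ^ 2 • (Tc.map (Int.cast : ℤ → ℝ) * (Tc.map (Int.cast : ℤ → ℝ)).transpose)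

end

/-! After filtering, what remains is the centred residue of Y = c + ∑ zᵢ eᵢ with z = Tcᵀd and c = r
dᵀρ. Both laws have total mass 1, so a one-sided estimate is enough: if the mass of Y at each point
of ℤ_q is at most (1 + δ) times the target mass, the distance is at most δ plus the overflow
probability (`statDist_cmod_le`).

The mass of Y is bounded by adding one summand at a time (`measureReal_sum_mul_eq_le`). A partial
sum of k terms lives on the multiples of the gcd d of its coefficients, and Poisson summation bounds
the next convolution by a Gaussian, up to a factor 1 + 4u^k with u = exp(-2π²σ²/‖z‖²). The exponent
k comes from k d² ≤ ∑ zᵢ² and keeps the product of all factors bounded independently of the number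
of terms. The dual lattice contains a pair ±y of norm at most one, hence 2 exp(-πη²) ≤ ε and u ≤
(ε/2)².

Truncation to ℤ_q costs a further factor (σ√(2π)/Z)^k, where Z is the normalizing constant of the
errors. The overflow hypothesis controls it (`ratio_pow_le`). If β is the mass of a block at either
end of ℤ_q, the base is at most 1 + 2β. A summand in an end block together with another in a
moderate block, compared with the opposite blocks, moves the sum by at least q, so one of the two
configurations overflows. Thus the overflow probability p is at least a constant times 1 - (1 -
2β)^k, and the factor is 1 + O(p). -/

/-! ### Gaussian sums over the integers. -/

theorem summable_exp_neg_add_sq {V : ℝ} (hV : 0 < V) (t : ℝ) :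
    Summable fun n : ℤ => Real.exp (-((n : ℝ) + t) ^ 2 / (2 * V)) := by
  have h := ((summable_jacobiTheta₂_term_iff
    (Complex.I * (t / (2 * Real.pi * V) : ℝ)) (Complex.I * (1 / (2 * Real.pi * V) : ℝ))).2
      (by simp; positivity)).norm.mul_left (Real.exp (-t ^ 2 / (2 * V)))
  refine h.congr fun n => ?_
  rw [norm_jacobiTheta₂_term, ← Real.exp_add]
  congr 1
  simp only [Complex.mul_im, Complex.I_re, Complex.I_im, Complex.ofReal_re, Complex.ofReal_im]
  have := Real.pi_pos
  field_simp
  ring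

/-- Since n² ≥ |n|, a two-sided geometric series dominates; its sum (1 + v)/(1 - v) is at most 1 +
4v for v ≤ 1/2. -/
theorem tsum_exp_neg_mul_sq_le {a : ℝ} (ha : Real.exp (-a) ≤ 1 / 2) :
    Summable (fun n : ℤ => Real.exp (-a * (n : ℝ) ^ 2)) ∧
      ∑' n : ℤ, Real.exp (-a * (n : ℝ) ^ 2) ≤ 1 + 4 * Real.exp (-a) := by
  set v := Real.exp (-a) with hv
  have hv0 : 0 < v := Real.exp_pos _
  have ha0 : 0 ≤ a := by
    by_contra h
    have := Real.add_one_le_exp (-a)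
    linarith
  have hle : ∀ n : ℤ, Real.exp (-a * (n : ℝ) ^ 2) ≤ v ^ n.natAbs := by
    intro n
    rw [hv, ← Real.exp_nat_mul, Real.exp_le_exp]
    have h1 : ((n.natAbs : ℕ) : ℝ) ≤ ((n.natAbs ^ 2 : ℕ) : ℝ) := by
      exact_mod_cast Nat.le_self_pow two_ne_zero _
    have h2 : ((n.natAbs ^ 2 : ℕ) : ℝ) = (n : ℝ) ^ 2 := by
      rw [Nat.cast_pow, Nat.cast_natAbs]
      push_cast
      exact sq_abs _
    rw [h2] at h1
    nlinarith
  have hg := hasSum_geometric_of_lt_one hv0.le (by linarith : v < 1)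
  have hs : HasSum (fun n : ℤ => v ^ n.natAbs) ((1 - v)⁻¹ + v * (1 - v)⁻¹) := by
    refine HasSum.of_nat_of_neg_add_one (by simpa using hg) ?_
    have h2 : (fun n : ℕ => v ^ (-((n : ℤ) + 1)).natAbs) = fun n : ℕ => v * v ^ n := by
      funext n
      have : (-((n : ℤ) + 1)).natAbs = n + 1 := by omega
      rw [this, pow_succ, mul_comm]
    rw [h2]
    exact hg.mul_left v
  have hsum : Summable (fun n : ℤ => Real.exp (-a * (n : ℝ) ^ 2)) :=
    Summable.of_nonneg_of_le (fun _ => (Real.exp_pos _).le) hle hs.summable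
  refine ⟨hsum, (hsum.tsum_le_tsum hle hs.summable).trans ?_⟩
  rw [hs.tsum_eq]
  have : (1 - v)⁻¹ + v * (1 - v)⁻¹ = (1 + v) / (1 - v) := by ring
  rw [this, div_le_iff₀ (by linarith)]
  nlinarith

/-- An upper bound for the sum of a Gaussian over a shifted copy of the integers, by Poisson
summation. -/
theorem tsum_exp_neg_add_sq_le {V : ℝ} (hV : 0 < V) (t : ℝ)
    (h : Real.exp (-(2 * Real.pi ^ 2 * V)) ≤ 1 / 2) :
    ∑' n : ℤ, Real.exp (-((n : ℝ) + t) ^ 2 / (2 * V))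
      ≤ Real.sqrt (2 * Real.pi * V) * (1 + 4 * Real.exp (-(2 * Real.pi ^ 2 * V))) := by
  have hpi := Real.pi_pos
  have ha : 0 < 2 * Real.pi * V := by positivity
  have hP := Complex.tsum_exp_neg_quadratic (a := ((2 * Real.pi * V : ℝ) : ℂ))
    (by rwa [Complex.ofReal_re]) (-Complex.I * t)
  have hterm : ∀ n : ℤ, Complex.exp (-Real.pi / ((2 * Real.pi * V : ℝ) : ℂ) *
      ((n : ℂ) + Complex.I * (-Complex.I * t)) ^ 2)
      = ((Real.exp (-((n : ℝ) + t) ^ 2 / (2 * V)) : ℝ) : ℂ) := by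
    intro n
    rw [Complex.ofReal_exp]
    congr 1
    have hI : Complex.I * (-Complex.I * t) = (t : ℂ) := by
      rw [← mul_assoc, mul_neg, Complex.I_mul_I]; ring
    rw [hI]
    have hVc : (V : ℂ) ≠ 0 := by exact_mod_cast hV.ne'
    have hpc : (Real.pi : ℂ) ≠ 0 := by exact_mod_cast hpi.ne'
    push_cast
    field_simp
  simp only [hterm] at hP
  rw [← Complex.ofReal_tsum] at hP
  obtain ⟨hS, hb⟩ := tsum_exp_neg_mul_sq_le h
  -- On the dual side the shift t only contributes a phase, so the bound is uniform in t.
  have hnorm : ∀ n : ℤ, ‖Complex.exp (-Real.pi * ((2 * Real.pi * V : ℝ) : ℂ) * (n : ℂ) ^ 2 +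
      2 * Real.pi * (-Complex.I * t) * n)‖ = Real.exp (-(2 * Real.pi ^ 2 * V) * (n : ℝ) ^ 2) := by
    intro n
    rw [Complex.norm_exp]
    congr 1
    have h1 : (-Real.pi * ((2 * Real.pi * V : ℝ) : ℂ) * (n : ℂ) ^ 2 +
      2 * Real.pi * (-Complex.I * t) * n) = ((-(2 * Real.pi ^ 2 * V) * (n : ℝ) ^ 2 : ℝ) : ℂ)
        + ((-2 * Real.pi * t * n : ℝ) : ℂ) * Complex.I := by
      push_cast; ring
    rw [h1, Complex.add_re, Complex.ofReal_re, Complex.re_ofReal_mul, Complex.I_re, mul_zero,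
      add_zero]
  have hle : ‖∑' n : ℤ, Complex.exp (-Real.pi * ((2 * Real.pi * V : ℝ) : ℂ) * (n : ℂ) ^ 2 +
      2 * Real.pi * (-Complex.I * t) * n)‖ ≤ 1 + 4 * Real.exp (-(2 * Real.pi ^ 2 * V)) := by
    refine (norm_tsum_le_tsum_norm (by simpa only [hnorm] using hS)).trans ?_
    simpa only [hnorm] using hb
  rw [hP, norm_mul, Complex.norm_real, norm_div, norm_one,
    Complex.norm_cpow_eq_rpow_re_of_pos ha] at hle
  have hr : ((1 / 2 : ℂ)).re = 1 / 2 := by norm_num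
  rw [hr, ← Real.sqrt_eq_rpow, Real.norm_of_nonneg (tsum_nonneg fun _ => (Real.exp_pos _).le),
    one_div, inv_mul_le_iff₀ (Real.sqrt_pos.2 ha)] at hle
  exact hle

/-- Without a shift all terms on the dual side of Poisson summation are positive, and the one at 0
equals 1. -/
theorem sqrt_le_tsum_exp_neg_sq {V : ℝ} (hV : 0 < V) :
    Real.sqrt (2 * Real.pi * V) ≤ ∑' n : ℤ, Real.exp (-(n : ℝ) ^ 2 / (2 * V)) := by
  have hpi := Real.pi_pos
  have ha : 0 < 2 * Real.pi * V := by positivity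
  have hP := Real.tsum_exp_neg_mul_int_sq ha
  have h1 : (1 : ℝ) ≤ ∑' n : ℤ, Real.exp (-Real.pi * (2 * Real.pi * V) * (n : ℝ) ^ 2) := by
    have hs := summable_exp_neg_add_sq (V := 1 / (4 * Real.pi ^ 2 * V)) (by positivity) 0
    have hs' : Summable fun n : ℤ => Real.exp (-Real.pi * (2 * Real.pi * V) * (n : ℝ) ^ 2) := by
      refine hs.congr fun n => ?_
      congr 1
      field_simp
      ring
    simpa using hs'.le_tsum 0 (fun _ _ => (Real.exp_pos _).le)
  have h2 : ∀ n : ℤ, Real.exp (-Real.pi / (2 * Real.pi * V) * (n : ℝ) ^ 2)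
      = Real.exp (-(n : ℝ) ^ 2 / (2 * V)) := by
    intro n
    congr 1
    field_simp
  simp only [h2] at hP
  rw [hP, ← Real.sqrt_eq_rpow, one_div, le_inv_mul_iff₀ (Real.sqrt_pos.2 ha), mul_one] at h1
  exact h1

/-! ### The smoothing parameter and the dual lattice. -/

theorem summable_prod_fin_of_nonneg {f : ℤ → ℝ} (hf : Summable f) (hf0 : ∀ n, 0 ≤ f n) (m : ℕ) :
    Summable fun k : Fin m → ℤ => ∏ i, f (k i) := by
  induction m with
  | zero => exact (hasSum_fintype _).summable
  | succ m ih =>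
    rw [← (Fin.consEquiv fun _ => ℤ).summable_iff]
    refine (Summable.mul_of_nonneg hf ih hf0
      (fun k => Finset.prod_nonneg fun _ _ => hf0 _)).congr fun k => ?_
    simp [Fin.prod_univ_succ]

theorem norm_realVec_sq {l : ℕ} (x : Fin l → ℤ) :
    ‖realVec x‖ ^ 2 = ∑ i, (x i : ℝ) ^ 2 := by
  rw [EuclideanSpace.norm_sq_eq]
  simp [realVec]

/-- The dual of a non-zero integral lattice has a non-zero vector of norm at most one. -/
theorem exists_dualLattice_norm_le_one {l : ℕ} {L : Submodule ℤ (Fin l → ℤ)} (hL : L ≠ ⊥) :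
    ∃ y ∈ dualLattice L, y ≠ 0 ∧ ‖y‖ ≤ 1 := by
  obtain ⟨x, hx, hx0⟩ := L.exists_mem_ne_zero_of_ne_bot hL
  obtain ⟨j, hj⟩ := Function.ne_iff.1 hx0
  set V := Submodule.span ℝ (realVec '' (L : Set (Fin l → ℤ))) with hV
  -- The witness is the projection of a coordinate vector to the span of the lattice: its inner
  -- products with lattice vectors are their j-th coordinates, which are integers.
  set b : EuclideanSpace ℝ (Fin l) := EuclideanSpace.single j (1 : ℝ)
  have hin : ∀ w ∈ L, inner ℝ (realVec w) (V.starProjection b) = (w j : ℝ) := by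
    intro w hw
    have hwV : realVec w ∈ V := Submodule.subset_span ⟨w, hw, rfl⟩
    rw [← Submodule.inner_starProjection_left_eq_right,
      Submodule.starProjection_eq_self_iff.2 hwV]
    rw [real_inner_comm, EuclideanSpace.inner_single_left]
    simp [realVec]
  refine ⟨V.starProjection b, ⟨Submodule.starProjection_apply_mem V b, fun w hw => ⟨w j, hin w hw⟩⟩, ?_, ?_⟩
  · intro h0
    have := hin x hx
    rw [h0, inner_zero_right] at this
    exact hj (by exact_mod_cast this.symm)
  · refine (V.norm_starProjection_apply_le b).trans ?_
    simp [b]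

/-- Gaussian sums over the dual lattice tend to zero. -/
theorem exists_dualLattice_tsum_le {l : ℕ} (L : Submodule ℤ (Fin l → ℤ)) {ε : ℝ} (hε : 0 < ε) :
    ∃ s : ℝ, 0 < s ∧ ∑' y : {y : EuclideanSpace ℝ (Fin l) // y ∈ dualLattice L ∧ y ≠ 0},
      ENNReal.ofReal (Real.exp (-Real.pi * s ^ 2 * ‖(y : EuclideanSpace ℝ (Fin l))‖ ^ 2))
        ≤ ENNReal.ofReal ε := by
  have hpi := Real.pi_pos
  -- A dual vector is determined by its integer inner products with finitely many generators, which
  -- embeds the dual lattice into ℤ^m and reduces the sum to a product of one-dimensional Gaussian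
  -- sums.
  obtain ⟨m, b, hb⟩ := Submodule.fg_iff_exists_fin_generating_family.1 (IsNoetherian.noetherian L)
  have hbL : ∀ i, b i ∈ L := fun i => hb ▸ Submodule.subset_span ⟨i, rfl⟩
  have hex : ∀ (y : {y : EuclideanSpace ℝ (Fin l) // y ∈ dualLattice L ∧ y ≠ 0}) (i : Fin m),
      ∃ k : ℤ, inner ℝ (realVec (b i)) y.1 = (k : ℝ) := fun y i => y.2.1.2 _ (hbL i)
  choose φ hφ using hex
  have hzero : ∀ y ∈ Submodule.span ℝ (realVec '' (L : Set (Fin l → ℤ))),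
      (∀ i, inner ℝ (realVec (b i)) y = (0 : ℝ)) → y = 0 := by
    intro y hy h0
    have h1 : ∀ w ∈ L, inner ℝ (realVec w) y = (0 : ℝ) := by
      intro w hw
      rw [← hb] at hw
      induction hw using Submodule.span_induction with
      | mem w hw => obtain ⟨i, rfl⟩ := hw; exact h0 i
      | zero => simp [realVec, PiLp.inner_apply]
      | add u v _ _ hu hv =>
        have : realVec (u + v) = realVec u + realVec v := by
          ext i; simp [realVec]
        rw [this, inner_add_left, hu, hv, add_zero]
      | smul a u _ hu =>
        have : realVec (a • u) = (a : ℝ) • realVec u := by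
          ext i; simp [realVec]
        rw [this, real_inner_smul_left, hu, mul_zero]
    have h2 : ∀ w ∈ Submodule.span ℝ (realVec '' (L : Set (Fin l → ℤ))), inner ℝ w y = (0 : ℝ) := by
      intro w hw
      induction hw using Submodule.span_induction with
      | mem w hw => obtain ⟨i, hi, rfl⟩ := hw; exact h1 i hi
      | zero => simp
      | add u v _ _ hu hv => rw [inner_add_left, hu, hv, add_zero]
      | smul a u _ hu => rw [real_inner_smul_left, hu, mul_zero]
    exact inner_self_eq_zero.1 (h2 y hy)
  have hinj : Function.Injective φ := by
    intro y y' h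
    apply Subtype.ext
    rw [← sub_eq_zero]
    refine hzero _ (Submodule.sub_mem _ y.2.1.1 y'.2.1.1) fun i => ?_
    rw [inner_sub_right, hφ, hφ, h, sub_self]
  set B : ℝ := 1 + ∑ i, ‖realVec (b i)‖ ^ 2 with hB
  have hB0 : 0 < B := by positivity
  have hnorm : ∀ y, ∑ i, (φ y i : ℝ) ^ 2 ≤ B * ‖y.1‖ ^ 2 := by
    intro y
    have : ∑ i, (φ y i : ℝ) ^ 2 ≤ ∑ i, ‖realVec (b i)‖ ^ 2 * ‖y.1‖ ^ 2 := by
      refine Finset.sum_le_sum fun i _ => ?_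
      rw [← hφ, ← mul_pow, ← sq_abs]
      exact pow_le_pow_left₀ (abs_nonneg _) (abs_real_inner_le_norm _ _) 2
    rw [← Finset.sum_mul] at this
    nlinarith [sq_nonneg ‖y.1‖]
  have hφ1 : ∀ y, (1 : ℝ) ≤ ∑ i, (φ y i : ℝ) ^ 2 := by
    intro y
    have hne : ∃ i, φ y i ≠ 0 := by
      by_contra! h
      exact y.2.2 (hzero _ y.2.1.1 fun i => by rw [hφ, h i, Int.cast_zero])
    obtain ⟨i, hi⟩ := hne
    have h1 : (1 : ℝ) ≤ (φ y i : ℝ) ^ 2 := by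
      have : (1 : ℤ) ≤ (φ y i) ^ 2 := by
        have := sq_pos_of_ne_zero hi
        omega
      exact_mod_cast this
    exact h1.trans (Finset.single_le_sum (f := fun i => (φ y i : ℝ) ^ 2)
      (fun _ _ => sq_nonneg _) (Finset.mem_univ i))
  have hsum : Summable fun k : Fin m → ℤ => Real.exp (-(Real.pi / B) * ∑ i, (k i : ℝ) ^ 2) := by
    have h1 : Summable fun n : ℤ => Real.exp (-(Real.pi / B) * (n : ℝ) ^ 2) := by
      refine (summable_exp_neg_add_sq (V := B / (2 * Real.pi)) (by positivity) 0).congr fun n => ?_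
      congr 1
      field_simp
      ring
    have h2 := summable_prod_fin_of_nonneg h1 (fun _ => (Real.exp_pos _).le) m
    refine h2.congr fun k => ?_
    rw [← Real.exp_sum, Finset.mul_sum]
  set A := ∑' k : Fin m → ℤ, Real.exp (-(Real.pi / B) * ∑ i, (k i : ℝ) ^ 2) with hA
  have hA0 : 0 ≤ A := tsum_nonneg fun _ => (Real.exp_pos _).le
  obtain ⟨t, ht⟩ : ∃ t : ℝ, 0 ≤ t ∧ Real.exp (-(Real.pi / B) * t) * A ≤ ε := by
    have hlim : Filter.Tendsto (fun t : ℝ => Real.exp (-(Real.pi / B) * t) * A) Filter.atTop (nhds (0 * A)) := by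
      refine Filter.Tendsto.mul_const _ (Real.tendsto_exp_atBot.comp ?_)
      exact Filter.Tendsto.const_mul_atTop_of_neg (by simpa using div_pos hpi hB0) Filter.tendsto_id
    rw [zero_mul] at hlim
    obtain ⟨t, ht⟩ := ((hlim.eventually_lt_const hε).and (Filter.eventually_ge_atTop 0)).exists
    exact ⟨t, ht.2, ht.1.le⟩
  -- With x = ∑ (φ y i)² ≥ 1 one has (1 + t)x ≥ x + t, so the choice s² = 1 + t pulls out the small
  -- factor exp(-(π/B)t).
  refine ⟨Real.sqrt (1 + t), Real.sqrt_pos.2 (by linarith), ?_⟩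
  rw [Real.sq_sqrt (by linarith)]
  calc _ ≤ ∑' y : {y : EuclideanSpace ℝ (Fin l) // y ∈ dualLattice L ∧ y ≠ 0},
        ENNReal.ofReal (Real.exp (-(Real.pi / B) * t) *
          Real.exp (-(Real.pi / B) * ∑ i, (φ y i : ℝ) ^ 2)) := by
        refine ENNReal.tsum_le_tsum fun y => ENNReal.ofReal_le_ofReal ?_
        rw [← Real.exp_add, Real.exp_le_exp]
        have h1 := hnorm y
        have h2 := hφ1 y
        have h3 : ∑ i, (φ y i : ℝ) ^ 2 + t ≤ (1 + t) * (B * ‖y.1‖ ^ 2) := by nlinarith [ht.1]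
        have h4 : Real.pi / B * (∑ i, (φ y i : ℝ) ^ 2 + t)
          ≤ Real.pi / B * ((1 + t) * (B * ‖y.1‖ ^ 2)) :=
            mul_le_mul_of_nonneg_left h3 (by positivity)
        have h5 : Real.pi / B * ((1 + t) * (B * ‖y.1‖ ^ 2)) = Real.pi * (1 + t) * ‖y.1‖ ^ 2 := by
          field_simp
        linarith
    _ ≤ ∑' k : Fin m → ℤ, ENNReal.ofReal (Real.exp (-(Real.pi / B) * t) *
          Real.exp (-(Real.pi / B) * ∑ i, (k i : ℝ) ^ 2)) :=
        ENNReal.tsum_comp_le_tsum_of_injective hinj _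
    _ = ENNReal.ofReal (Real.exp (-(Real.pi / B) * t) * A) := by
        rw [← ENNReal.ofReal_tsum_of_nonneg (fun _ => by positivity) (hsum.mul_left _), tsum_mul_left]
    _ ≤ ENNReal.ofReal ε := ENNReal.ofReal_le_ofReal ht.2

/-- A short dual vector and its negative already contribute 2 exp(-πs²) to the defining sum. -/
theorem two_mul_exp_smoothingParameter_le {l : ℕ} {L : Submodule ℤ (Fin l → ℤ)} (hL : L ≠ ⊥)
    {ε : ℝ} (hε : 0 < ε) (hε1 : ε < 1) :
    2 * Real.exp (-Real.pi * smoothingParameter L ε ^ 2) ≤ ε := by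
  have hpi := Real.pi_pos
  have hlog : 0 < Real.log (2 / ε) := Real.log_pos (by rw [lt_div_iff₀ hε]; linarith)
  have hle : Real.sqrt (Real.log (2 / ε) / Real.pi) ≤ smoothingParameter L ε := by
    -- Non-emptiness of the defining set matters: `sInf` of the empty set would be 0.
    refine le_csInf (exists_dualLattice_tsum_le L hε) ?_
    rintro s ⟨hs, hsum⟩
    obtain ⟨y, ⟨hyV, hyL⟩, hy0, hy1⟩ := exists_dualLattice_norm_le_one hL
    have hyneg : -y ∈ dualLattice L := by
      refine ⟨Submodule.neg_mem _ hyV, fun x hx => ?_⟩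
      obtain ⟨k, hk⟩ := hyL x hx
      exact ⟨-k, by rw [inner_neg_right, hk, Int.cast_neg]⟩
    set Y : {y : EuclideanSpace ℝ (Fin l) // y ∈ dualLattice L ∧ y ≠ 0} := ⟨y, ⟨hyV, hyL⟩, hy0⟩
    set Y' : {y : EuclideanSpace ℝ (Fin l) // y ∈ dualLattice L ∧ y ≠ 0} :=
      ⟨-y, hyneg, neg_ne_zero.2 hy0⟩
    have hYY : Y ≠ Y' := by
      intro h
      have h1 : y = -y := Subtype.ext_iff.1 h
      have h2 : (2 : ℝ) • y = 0 := by
        rw [two_smul]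
        nth_rewrite 2 [h1]
        exact add_neg_cancel y
      exact hy0 (by simpa using h2)
    have h2 := (ENNReal.sum_le_tsum {Y, Y'} (f := fun y : {y : EuclideanSpace ℝ (Fin l) //
      y ∈ dualLattice L ∧ y ≠ 0} => ENNReal.ofReal (Real.exp (-Real.pi * s ^ 2 *
        ‖(y : EuclideanSpace ℝ (Fin l))‖ ^ 2)))).trans hsum
    rw [Finset.sum_pair hYY, ← ENNReal.ofReal_add (by positivity) (by positivity),
      ENNReal.ofReal_le_ofReal_iff hε.le] at h2
    simp only [Y, Y', norm_neg] at h2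
    have h3 : Real.exp (-Real.pi * s ^ 2) ≤ Real.exp (-Real.pi * s ^ 2 * ‖y‖ ^ 2) := by
      rw [Real.exp_le_exp]
      have : ‖y‖ ^ 2 ≤ 1 := pow_le_one₀ (norm_nonneg _) hy1
      nlinarith [mul_pos hpi (pow_pos hs 2)]
    rw [Real.sqrt_le_iff]
    refine ⟨hs.le, ?_⟩
    rw [div_le_iff₀ hpi, Real.log_le_iff_le_exp (by positivity), div_le_iff₀ hε]
    have h4 : Real.exp (s ^ 2 * Real.pi) * Real.exp (-Real.pi * s ^ 2) = 1 := by
      rw [← Real.exp_add]; simp [mul_comm]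
    nlinarith [Real.exp_pos (s ^ 2 * Real.pi)]
  have h1 : Real.log (2 / ε) / Real.pi ≤ smoothingParameter L ε ^ 2 := by
    rw [← Real.sq_sqrt (div_pos hlog hpi).le]
    exact pow_le_pow_left₀ (Real.sqrt_nonneg _) hle 2
  rw [div_le_iff₀ hpi] at h1
  have h2 : Real.exp (-Real.pi * smoothingParameter L ε ^ 2) ≤ Real.exp (-Real.log (2 / ε)) := by
    rw [Real.exp_le_exp]; linarith
  rw [Real.exp_neg, Real.exp_log (by positivity), inv_div] at h2
  linarith

/-! ### Upper bound for the mass function of an integer combination. -/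

/-- A Gaussian times a shifted Gaussian, summed over an arithmetic progression. -/
theorem tsum_exp_mul_exp_le {σ s a D v : ℝ} (hσ : 0 < σ) (hs : 0 < s) (hD : 0 < D) (g y : ℝ)
    (hv : Real.exp (-(2 * Real.pi ^ 2 * (σ ^ 2 * s / ((s + a ^ 2) * D ^ 2)))) ≤ v)
    (hv2 : v ≤ 1 / 2) :
    Summable (fun k : ℤ => Real.exp (-(g + D * k) ^ 2 / (2 * σ ^ 2)) *
        Real.exp (-(y - a * (g + D * k)) ^ 2 / (2 * (σ ^ 2 * s)))) ∧
      ∑' k : ℤ, Real.exp (-(g + D * k) ^ 2 / (2 * σ ^ 2)) *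
        Real.exp (-(y - a * (g + D * k)) ^ 2 / (2 * (σ ^ 2 * s)))
      ≤ σ * Real.sqrt (2 * Real.pi) * (1 + 4 * v) * (Real.sqrt s / (Real.sqrt (s + a ^ 2) * D)) *
        Real.exp (-y ^ 2 / (2 * (σ ^ 2 * (s + a ^ 2)))) := by
  have hpi := Real.pi_pos
  have hs' : 0 < s + a ^ 2 := by positivity
  -- V and -t are the variance and mean in k after completing the square.
  set V := σ ^ 2 * s / ((s + a ^ 2) * D ^ 2) with hV
  have hV0 : 0 < V := by positivity
  set t := (g - a * y / (s + a ^ 2)) / D with ht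
  have hterm : ∀ k : ℤ, Real.exp (-(g + D * k) ^ 2 / (2 * σ ^ 2)) *
        Real.exp (-(y - a * (g + D * k)) ^ 2 / (2 * (σ ^ 2 * s)))
      = Real.exp (-y ^ 2 / (2 * (σ ^ 2 * (s + a ^ 2)))) *
        Real.exp (-((k : ℝ) + t) ^ 2 / (2 * V)) := by
    intro k
    rw [← Real.exp_add, ← Real.exp_add]
    congr 1
    rw [hV, ht]
    field_simp
    ring
  simp only [hterm]
  have hsm := summable_exp_neg_add_sq hV0 t
  refine ⟨hsm.mul_left _, ?_⟩
  rw [tsum_mul_left, mul_comm]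
  refine mul_le_mul_of_nonneg_right ?_ (Real.exp_pos _).le
  refine (tsum_exp_neg_add_sq_le hV0 t (hv.trans hv2)).trans ?_
  have hsqrt : Real.sqrt (2 * Real.pi * V)
      = σ * Real.sqrt (2 * Real.pi) * (Real.sqrt s / (Real.sqrt (s + a ^ 2) * D)) := by
    rw [Real.sqrt_mul (by positivity), hV, Real.sqrt_div (by positivity),
      Real.sqrt_mul (sq_nonneg σ), Real.sqrt_mul hs'.le, Real.sqrt_sq hσ.le, Real.sqrt_sq hD.le]
    ring
  rw [hsqrt]
  have : 1 + 4 * Real.exp (-(2 * Real.pi ^ 2 * V)) ≤ 1 + 4 * v := by linarith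
  calc _ ≤ σ * Real.sqrt (2 * Real.pi) * (Real.sqrt s / (Real.sqrt (s + a ^ 2) * D)) * (1 + 4 * v) :=
        mul_le_mul_of_nonneg_left this (by positivity)
    _ = _ := by ring

section
variable {Ω : Type*} [MeasurableSpace Ω] {P : Measure Ω} [IsProbabilityMeasure P]

/-- One convolution step. Since W is a multiple of d, the values of E compatible with W + aE = y
form part of one residue class modulo D = d / gcd(d, a). If B carries the density factor d/√s of W,
the new factor turns it into gcd(d, a)/√(s + a²). -/
theorem measureReal_add_mul_eq_le {W E : Ω → ℤ} (hind : IndepFun W E P) {σ s B Z v : ℝ}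
    (hσ : 0 < σ) (hs : 0 < s) (hB : 0 ≤ B) (hZ : 0 < Z) {a : ℤ} {d : ℕ} (hd : 0 < d)
    (hWd : ∀ ω, (d : ℤ) ∣ W ω)
    (hWb : ∀ w : ℤ, P.real {ω | W ω = w} ≤ B * Real.exp (-(w : ℝ) ^ 2 / (2 * (σ ^ 2 * s))))
    (hEb : ∀ x : ℤ, P.real {ω | E ω = x} ≤ Real.exp (-(x : ℝ) ^ 2 / (2 * σ ^ 2)) / Z)
    (hv : Real.exp (-(2 * Real.pi ^ 2 * (σ ^ 2 * s / ((s + (a : ℝ) ^ 2) * (d : ℝ) ^ 2)))) ≤ v)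
    (hv2 : v ≤ 1 / 2) (y : ℤ) :
    P.real {ω | W ω + a * E ω = y} ≤ B * (σ * Real.sqrt (2 * Real.pi) / Z) * (1 + 4 * v) *
      (Real.sqrt s * Int.gcd d a / (Real.sqrt (s + (a : ℝ) ^ 2) * d)) *
        Real.exp (-(y : ℝ) ^ 2 / (2 * (σ ^ 2 * (s + (a : ℝ) ^ 2)))) := by
  have hpi := Real.pi_pos
  have hv0 : 0 ≤ v := (Real.exp_pos _).le.trans hv
  -- Any solution ω₀ supplies a representative g of the residue class; without one the mass is zero.
  rcases Set.eq_empty_or_nonempty {ω | W ω + a * E ω = y} with h | ⟨ω₀, hω₀⟩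
  · rw [h, measureReal_empty]
    positivity
  set g := E ω₀ with hg
  have hG : 0 < Int.gcd d a := Int.gcd_pos_of_ne_zero_left _ (by exact_mod_cast hd.ne')
  obtain ⟨D, hD⟩ : Int.gcd d a ∣ d := by exact_mod_cast Int.gcd_dvd_left (a := (d : ℤ)) (b := a)
  have hD0 : 0 < D := Nat.pos_of_ne_zero (by rintro rfl; omega)
  have hDd : D ≤ d := by rw [hD]; exact Nat.le_mul_of_pos_left _ hG
  have hsub : {ω | W ω + a * E ω = y} ⊆
      ⋃ k : ℤ, {ω | W ω = y - a * (g + D * k)} ∩ {ω | E ω = g + D * k} := by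
    intro ω hω
    simp only [Set.mem_ofPred_eq] at hω hω₀
    have h1 : (d : ℤ) ∣ a * (E ω - g) := by
      have : a * (E ω - g) = W ω₀ - W ω := by rw [mul_sub]; linarith
      rw [this]
      exact dvd_sub (hWd _) (hWd _)
    have h2 : (D : ℤ) ∣ E ω - g := by
      obtain ⟨a', ha'⟩ := Int.gcd_dvd_right (a := (d : ℤ)) (b := a)
      have hG' : ((Int.gcd d a : ℕ) : ℤ) ≠ 0 := by exact_mod_cast hG.ne'
      have hdD : (d : ℤ) = (Int.gcd d a : ℕ) * D := by exact_mod_cast hD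
      have h3 : (D : ℤ) ∣ a' * (E ω - g) := by
        have : ((Int.gcd d a : ℕ) : ℤ) * D ∣ (Int.gcd d a : ℕ) * (a' * (E ω - g)) := by
          rw [← hdD, ← mul_assoc, ← ha']
          exact h1
        exact (mul_dvd_mul_iff_left hG').1 this
      refine IsCoprime.dvd_of_dvd_mul_left ?_ h3
      rw [Int.isCoprime_iff_gcd_eq_one]
      have h4 := Int.gcd_mul_left ((Int.gcd d a : ℕ) : ℤ) D a'
      rw [← hdD, ← ha', Int.natAbs_natCast] at h4
      exact Nat.eq_of_mul_eq_mul_left hG (by rw [mul_one]; exact h4.symm)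
    obtain ⟨k, hk⟩ := h2
    refine Set.mem_iUnion.2 ⟨k, ?_, ?_⟩
    · simp only [Set.mem_ofPred_eq]
      have : E ω = g + D * k := by linarith
      rw [← this]; linarith
    · simp only [Set.mem_ofPred_eq]
      linarith
  have hDr : (0 : ℝ) < D := by exact_mod_cast hD0
  have hdr : (0 : ℝ) < d := by exact_mod_cast hd
  have hv' : Real.exp (-(2 * Real.pi ^ 2 * (σ ^ 2 * s / ((s + (a : ℝ) ^ 2) * (D : ℝ) ^ 2)))) ≤ v := by
    refine le_trans ?_ hv
    rw [Real.exp_le_exp, neg_le_neg_iff]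
    have : (D : ℝ) ≤ d := by exact_mod_cast hDd
    gcongr
  obtain ⟨hsm, hle⟩ := tsum_exp_mul_exp_le (a := (a : ℝ)) hσ hs hDr g y hv' hv2
  have key : P {ω | W ω + a * E ω = y} ≤ ENNReal.ofReal (∑' k : ℤ, B / Z *
      (Real.exp (-((g : ℝ) + D * k) ^ 2 / (2 * σ ^ 2)) *
        Real.exp (-((y : ℝ) - a * (g + D * k)) ^ 2 / (2 * (σ ^ 2 * s))))) := by
    rw [ENNReal.ofReal_tsum_of_nonneg (fun _ => by positivity) (hsm.mul_left _)]
    refine (measure_mono hsub).trans ((measure_iUnion_le _).trans (ENNReal.tsum_le_tsum fun k => ?_))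
    have hi := hind.measure_inter_preimage_eq_mul {y - a * (g + D * k)} {g + D * k}
      (measurableSet_singleton _) (measurableSet_singleton _)
    refine (le_of_eq hi).trans ?_
    rw [← ofReal_measureReal, ← ofReal_measureReal, ← ENNReal.ofReal_mul measureReal_nonneg]
    refine ENNReal.ofReal_le_ofReal ?_
    have h1 := hWb (y - a * (g + D * k))
    have h2 := hEb (g + D * k)
    push_cast at h1 h2
    refine (mul_le_mul h1 h2 measureReal_nonneg (by positivity)).trans (le_of_eq ?_)
    ring
  rw [measureReal_def]
  refine ENNReal.toReal_le_of_le_ofReal (by positivity) (key.trans (ENNReal.ofReal_le_ofReal ?_))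
  rw [tsum_mul_left]
  refine (mul_le_mul_of_nonneg_left hle (by positivity)).trans (le_of_eq ?_)
  have hdD : (d : ℝ) = (Int.gcd d a : ℕ) * D := by exact_mod_cast hD
  have hGr : (0 : ℝ) < (Int.gcd d a : ℕ) := by exact_mod_cast hG
  have : Real.sqrt s / (Real.sqrt (s + (a : ℝ) ^ 2) * D)
      = Real.sqrt s * (Int.gcd d a : ℕ) / (Real.sqrt (s + (a : ℝ) ^ 2) * d) := by
    have : 0 < Real.sqrt (s + (a : ℝ) ^ 2) := Real.sqrt_pos.2 (by positivity)
    rw [hdD]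
    field_simp
  rw [this]
  ring

/-- The mass function of an integer combination of independent discrete Gaussians, possibly
truncated, is bounded by a Gaussian on the multiples of the greatest common divisor of the
coefficients. -/
theorem measureReal_sum_mul_eq_le {ι : Type*} [DecidableEq ι] {e : ι → Ω → ℤ}
    (hm : ∀ i, Measurable (e i)) (hi : iIndepFun e P) {σ Z R u : ℝ} (hσ : 0 < σ) (hZ : 0 < Z)
    (he : ∀ i (x : ℤ), P.real {ω | e i ω = x} ≤ Real.exp (-(x : ℝ) ^ 2 / (2 * σ ^ 2)) / Z)
    (z : ι → ℤ) (hu : u = Real.exp (-(2 * Real.pi ^ 2 * (σ ^ 2 / R)))) (hu2 : u ≤ 1 / 2)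
    {S : Finset ι} (hS : S.Nonempty) (hz : ∀ i ∈ S, z i ≠ 0) (hR : ∑ i ∈ S, (z i : ℝ) ^ 2 ≤ R)
    (y : ℤ) :
    P.real {ω | ∑ i ∈ S, z i * e i ω = y} ≤
      (Z⁻¹ * (σ * Real.sqrt (2 * Real.pi) / Z) ^ (S.card - 1) *
        (∏ k ∈ Finset.range (S.card - 1), (1 + 4 * u ^ (k + 1))) *
        ((S.gcd z).natAbs / Real.sqrt (∑ i ∈ S, (z i : ℝ) ^ 2))) *
        Real.exp (-(y : ℝ) ^ 2 / (2 * (σ ^ 2 * ∑ i ∈ S, (z i : ℝ) ^ 2))) := by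
  have hpi := Real.pi_pos
  have hu0 : 0 < u := hu ▸ Real.exp_pos _
  induction hS using Finset.Nonempty.cons_induction generalizing y with
  | singleton i =>
    have hzi : z i ≠ 0 := hz i (by simp)
    have hzr : (z i : ℝ) ≠ 0 := by exact_mod_cast hzi
    simp only [Finset.sum_singleton, Finset.card_singleton, Nat.sub_self, pow_zero, mul_one,
      Finset.range_zero, Finset.prod_empty, Finset.gcd_singleton, Real.sqrt_sq_eq_abs]
    have h1 : ((normalize (z i)).natAbs : ℝ) / |(z i : ℝ)| = 1 := by
      rw [← Int.abs_eq_normalize, Int.natAbs_abs, Nat.cast_natAbs, Int.cast_abs]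
      exact div_self (abs_ne_zero.2 hzr)
    rw [h1, mul_one]
    by_cases hdvd : z i ∣ y
    · obtain ⟨x, rfl⟩ := hdvd
      have h2 : {ω | z i * e i ω = z i * x} = {ω | e i ω = x} := by
        ext ω
        simp [hzi]
      rw [h2]
      refine (he i x).trans (le_of_eq ?_)
      rw [div_eq_inv_mul]
      congr 2
      push_cast
      field_simp
    · have h2 : {ω | z i * e i ω = y} = ∅ := by
        ext ω
        simp only [Set.mem_ofPred_eq, Set.mem_empty_iff_false, iff_false]
        rintro rfl
        exact hdvd (dvd_mul_right _ _)
      rw [h2, measureReal_empty]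
      positivity
  | cons a S ha hS ih =>
    have hzS : ∀ i ∈ S, z i ≠ 0 := fun i hi => hz i (Finset.mem_cons_of_mem hi)
    rw [Finset.sum_cons] at hR
    have hRS : ∑ i ∈ S, (z i : ℝ) ^ 2 ≤ R := by nlinarith [sq_nonneg (z a : ℝ)]
    have ih' := ih hzS hRS
    set s := ∑ i ∈ S, (z i : ℝ) ^ 2 with hs_def
    set d := (S.gcd z).natAbs with hd_def
    obtain ⟨i₀, hi₀⟩ := hS
    have hd : 0 < d := by
      rw [hd_def, Int.natAbs_pos]
      intro h
      exact hzS i₀ hi₀ (Finset.gcd_eq_zero_iff.1 h i₀ hi₀)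
    have hdz : ∀ i ∈ S, (d : ℤ) ∣ z i := fun i hi => by
      rw [hd_def, Int.natAbs_dvd]
      exact Finset.gcd_dvd hi
    -- Every coefficient is a non-zero multiple of d. This is the source of the power `u ^ S.card`
    -- below, hence of a bound independent of the number of summands.
    have hds : (S.card : ℝ) * (d : ℝ) ^ 2 ≤ s := by
      rw [hs_def, ← nsmul_eq_mul]
      refine Finset.card_nsmul_le_sum _ _ _ fun i hi => ?_
      have h1 : d ≤ (z i).natAbs :=
        Nat.le_of_dvd (Int.natAbs_pos.2 (hzS i hi)) (Int.natCast_dvd.1 (hdz i hi))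
      have h2 : ((z i).natAbs : ℝ) ^ 2 = (z i : ℝ) ^ 2 := by
        rw [Nat.cast_natAbs, Int.cast_abs, sq_abs]
      rw [← h2]
      gcongr
    have hcard : 0 < S.card := Finset.card_pos.2 ⟨i₀, hi₀⟩
    have hs : 0 < s := lt_of_lt_of_le (by positivity) hds
    have hR0 : 0 < R := lt_of_lt_of_le hs hRS
    have hind : IndepFun (fun ω => ∑ i ∈ S, z i * e i ω) (e a) P := by
      have h1 := hi.indepFun_finset S {a} (by simpa using ha) hm
      have hφ : Measurable fun f : (i : S) → ℤ => ∑ i : S, z i * f i := by fun_prop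
      have hψ : Measurable fun f : (i : ({a} : Finset ι)) → ℤ => f ⟨a, by simp⟩ :=
        measurable_pi_apply _
      have h2 := h1.comp hφ hψ
      have h3 : (fun ω => ∑ i ∈ S, z i * e i ω)
          = (fun f : (i : S) → ℤ => ∑ i : S, z i * f i) ∘ fun ω (i : S) => e i ω :=
        funext fun ω => (Finset.sum_coe_sort S fun i => z i * e i ω).symm
      rw [h3]
      exact h2
    have hv : Real.exp (-(2 * Real.pi ^ 2 * (σ ^ 2 * s / ((s + (z a : ℝ) ^ 2) * (d : ℝ) ^ 2))))
        ≤ u ^ S.card := by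
      rw [hu, ← Real.exp_nat_mul, Real.exp_le_exp]
      have hdr : (0 : ℝ) < d := by exact_mod_cast hd
      have h1 : (S.card : ℝ) * (σ ^ 2 / R) ≤ σ ^ 2 * s / ((s + (z a : ℝ) ^ 2) * (d : ℝ) ^ 2) := by
        rw [mul_div_assoc', div_le_div_iff₀ hR0 (by positivity)]
        have h3 : (S.card : ℝ) * (d : ℝ) ^ 2 * (s + (z a : ℝ) ^ 2) ≤ s * R :=
          mul_le_mul hds (by linarith) (by positivity) hs.le
        calc _ = σ ^ 2 * ((S.card : ℝ) * (d : ℝ) ^ 2 * (s + (z a : ℝ) ^ 2)) := by ring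
          _ ≤ σ ^ 2 * (s * R) := by gcongr
          _ = _ := by ring
      have h2 := mul_le_mul_of_nonneg_left h1 (by positivity : (0 : ℝ) ≤ 2 * Real.pi ^ 2)
      linarith
    have hv2 : u ^ S.card ≤ 1 / 2 := by
      refine le_trans ?_ hu2
      exact pow_le_of_le_one hu0.le (by linarith) hcard.ne'
    have hstep := measureReal_add_mul_eq_le hind hσ hs (by positivity) hZ (a := z a) hd
      (fun ω => Finset.dvd_sum fun i hi => (hdz i hi).mul_right _) ih' (he a) hv hv2 y
    have hset : {ω | ∑ i ∈ Finset.cons a S ha, z i * e i ω = y}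
        = {ω | ∑ i ∈ S, z i * e i ω + z a * e a ω = y} := by
      ext ω
      simp only [Finset.sum_cons, Set.mem_ofPred_eq, add_comm]
    rw [hset]
    refine hstep.trans (le_of_eq ?_)
    have hgcd : ((Finset.cons a S ha).gcd z).natAbs = Int.gcd d (z a) := by
      rw [Finset.cons_eq_insert, Finset.gcd_insert, hd_def]
      change Int.natAbs (Int.gcd (z a) (S.gcd z)) = _
      rw [Int.natAbs_natCast, Int.gcd_comm]
      simp only [Int.gcd, Int.natAbs_natCast]
    rw [hgcd, Finset.sum_cons, ← hs_def, Finset.card_cons, Nat.add_sub_cancel,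
      add_comm ((z a : ℝ) ^ 2) s]
    obtain ⟨c, hc⟩ : ∃ c, S.card = c + 1 := ⟨S.card - 1, by omega⟩
    rw [hc, Nat.add_sub_cancel, Finset.prod_range_succ, pow_succ (σ * Real.sqrt (2 * Real.pi) / Z) c]
    have hdr : (d : ℝ) ≠ 0 := by exact_mod_cast hd.ne'
    have hsq : Real.sqrt s ≠ 0 := (Real.sqrt_pos.2 hs).ne'
    have hsq2 : Real.sqrt (s + (z a : ℝ) ^ 2) ≠ 0 := (Real.sqrt_pos.2 (by positivity)).ne'
    field_simp

end

/-! ### Lower bounds for the overflow probability. -/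

section
variable {Ω : Type*} [MeasurableSpace Ω] {P : Measure Ω} [IsProbabilityMeasure P]

/-- If two pairs of blocks for a couple of independent summands are so far apart that they cannot
both bring the sum into a short window, then the sum leaves the window with a probability that is
bounded below, conditionally on the other summands. -/
theorem mul_le_measureReal_notMem {ι : Type*} [DecidableEq ι] {e : ι → Ω → ℤ}
    (hm : ∀ i, Measurable (e i)) (hi : iIndepFun e P) (z : ι → ℤ) (c : ℤ) {S : Finset ι} {i j : ι}
    (hiS : i ∈ S) (hjS : j ∈ S) (hij : i ≠ j) {w : Set ℤ} {q : ℤ}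
    (hw : ∀ v ∈ w, ∀ v' ∈ w, v - v' < q) {A₁ A₂ B₁ B₂ : Set ℤ}
    (hq : ∀ x ∈ A₁, ∀ x' ∈ A₂, ∀ y ∈ B₁, ∀ y' ∈ B₂, q ≤ z i * (x - x') + z j * (y - y')) {β : ℝ}
    (h₁ : β ≤ P.real {ω | e i ω ∈ A₁} * P.real {ω | e j ω ∈ B₁})
    (h₂ : β ≤ P.real {ω | e i ω ∈ A₂} * P.real {ω | e j ω ∈ B₂})
    {S' : Finset ι} (hS' : S' = (S.erase i).erase j) (Q : Set (S' → ℤ)) :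
    P.real {ω | (fun k : S' => e k ω) ∈ Q} * β ≤ P.real {ω | (fun k : S' => e k ω) ∈ Q ∧
        ((e i ω ∈ A₁ ∧ e j ω ∈ B₁) ∨ (e i ω ∈ A₂ ∧ e j ω ∈ B₂)) ∧
        c + ∑ k ∈ S, z k * e k ω ∉ w} := by
  set f : Ω → (S' → ℤ) := fun ω k => e k ω with hf
  have hfm : Measurable f := measurable_pi_lambda _ fun k => hm k
  -- Values of the remaining summands for which the first pair of blocks always misses the window;
  -- off this set the second pair always does.
  set O : Set (S' → ℤ) :=
    {g | ∀ x ∈ A₁, ∀ y ∈ B₁, c + (z i * x + (z j * y + ∑ k : S', z k * g k)) ∉ w} with hO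
  have hsum : ∀ ω, c + ∑ k ∈ S, z k * e k ω
      = c + (z i * e i ω + (z j * e j ω + ∑ k : S', z k * f ω k)) := by
    intro ω
    rw [← Finset.add_sum_erase S _ hiS, ← Finset.add_sum_erase (S.erase i) _
      (Finset.mem_erase.2 ⟨hij.symm, hjS⟩), ← hS', ← Finset.sum_coe_sort S']
  have hindep : ∀ (U : Set (S' → ℤ)) (A B : Set ℤ),
      P.real {ω | f ω ∈ U ∧ e i ω ∈ A ∧ e j ω ∈ B}
        = P.real {ω | f ω ∈ U} * (P.real {ω | e i ω ∈ A} * P.real {ω | e j ω ∈ B}) := by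
    intro U A B
    have hdis : Disjoint S' ({i, j} : Finset ι) := by
      rw [Finset.disjoint_left]
      intro k hk hk'
      simp only [hS', Finset.mem_erase, Finset.mem_insert, Finset.mem_singleton] at hk hk'
      tauto
    have h1 := (hi.indepFun_finset S' {i, j} hdis hm).measure_inter_preimage_eq_mul U
      {g | g ⟨i, by simp⟩ ∈ A ∧ g ⟨j, by simp⟩ ∈ B} (MeasurableSet.of_discrete)
      (MeasurableSet.of_discrete)
    have h2 := (hi.indepFun hij).measure_inter_preimage_eq_mul A B (MeasurableSet.of_discrete)
      (MeasurableSet.of_discrete)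
    simp only [measureReal_def, ← ENNReal.toReal_mul]
    congr 1
    refine h1.trans ?_
    congr 1
  have hbound : ∀ (U : Set (S' → ℤ)) (A B : Set ℤ),
      β ≤ P.real {ω | e i ω ∈ A} * P.real {ω | e j ω ∈ B} →
      P.real {ω | f ω ∈ U} * β ≤ P.real {ω | f ω ∈ U ∧ e i ω ∈ A ∧ e j ω ∈ B} := by
    intro U A B h
    rw [hindep]
    exact mul_le_mul_of_nonneg_left h measureReal_nonneg
  have hQ : P.real {ω | f ω ∈ Q} = P.real {ω | f ω ∈ Q ∩ O} + P.real {ω | f ω ∈ Q \ O} :=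
    (measureReal_inter_add_sdiff (s := {ω | f ω ∈ Q}) (t := {ω | f ω ∈ O})
      (hfm MeasurableSet.of_discrete)).symm
  have hdisj : Disjoint {ω | f ω ∈ Q ∩ O ∧ e i ω ∈ A₁ ∧ e j ω ∈ B₁}
      {ω | f ω ∈ Q \ O ∧ e i ω ∈ A₂ ∧ e j ω ∈ B₂} :=
    Set.disjoint_left.2 fun ω h h' => h'.1.2 h.1.2
  have hmeas : MeasurableSet {ω | f ω ∈ Q \ O ∧ e i ω ∈ A₂ ∧ e j ω ∈ B₂} :=
    (hfm MeasurableSet.of_discrete).inter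
      ((hm i MeasurableSet.of_discrete).inter (hm j MeasurableSet.of_discrete))
  change P.real {ω | f ω ∈ Q} * β ≤ _
  rw [hQ, add_mul]
  refine (add_le_add (hbound _ A₁ B₁ h₁) (hbound _ A₂ B₂ h₂)).trans ?_
  rw [← measureReal_union hdisj hmeas]
  refine measureReal_mono ?_
  rintro ω (⟨⟨hωQ, hωO⟩, hA, hB⟩ | ⟨⟨hωQ, hωO⟩, hA, hB⟩)
  · refine ⟨hωQ, Or.inl ⟨hA, hB⟩, ?_⟩
    rw [hsum]
    exact hωO _ hA _ hB
  · refine ⟨hωQ, Or.inr ⟨hA, hB⟩, ?_⟩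
    rw [hsum]
    intro hmem
    simp only [hO, Set.mem_ofPred_eq, not_forall, not_not] at hωO
    obtain ⟨x, hx, y, hy, hxy⟩ := hωO
    have h3 := hw _ hxy _ hmem
    have h4 := hq x hx _ hA y hy _ hB
    nlinarith

/-- The overflow event is split according to the first index i whose summand lies in N₁ ∪ N₂, with
some partner j(i) in M₁ ∪ M₂. The case of index i has probability at least βμ(1 - ν)^m, m being the
number of earlier indices, and the sum over i telescopes. -/
theorem mul_one_sub_pow_le_measureReal_notMem {ι : Type*} [LinearOrder ι] {e : ι → Ω → ℤ}
    (hm : ∀ i, Measurable (e i)) (hi : iIndepFun e P) (z : ι → ℤ) (c : ℤ) {S : Finset ι}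
    (hS : S.Nontrivial) (hz : ∀ i ∈ S, z i ≠ 0) {w : Set ℤ} {q a b : ℤ}
    (hw : ∀ v ∈ w, ∀ v' ∈ w, v - v' < q) (ha : 0 ≤ a) (hb : 0 ≤ b) (hab : q ≤ a + b)
    {N₁ N₂ M₁ M₂ : Set ℤ} (hN : ∀ x ∈ N₁, ∀ x' ∈ N₂, a ≤ x - x')
    (hM : ∀ y ∈ M₁, ∀ y' ∈ M₂, b ≤ y - y') (hNM : Disjoint (N₁ ∪ N₂) (M₁ ∪ M₂))
    {β μ ν : ℝ} (hβ : 0 ≤ β) (hμ : 0 ≤ μ)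
    (hN₁ : ∀ i, β ≤ P.real {ω | e i ω ∈ N₁}) (hN₂ : ∀ i, β ≤ P.real {ω | e i ω ∈ N₂})
    (hM₁ : ∀ i, μ ≤ P.real {ω | e i ω ∈ M₁}) (hM₂ : ∀ i, μ ≤ P.real {ω | e i ω ∈ M₂})
    (hν : ∀ i, P.real {ω | e i ω ∈ N₁ ∪ N₂} = ν) :
    β * μ * (1 - (1 - ν) ^ S.card) ≤ ν * P.real {ω | c + ∑ k ∈ S, z k * e k ω ∉ w} := by
  have hν0 : ∀ i ∈ S, 0 ≤ ν ∧ ν ≤ 1 := fun i _ => hν i ▸ ⟨measureReal_nonneg, measureReal_le_one⟩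
  obtain ⟨i₀, hi₀⟩ := hS.nonempty
  obtain ⟨hν0, hν1⟩ := hν0 i₀ hi₀
  have hex : ∀ i, ∃ j, i ∈ S → j ∈ S ∧ j ≠ i := by
    intro i
    by_cases h : i ∈ S
    · obtain ⟨j, hj, hne⟩ := hS.exists_ne i
      exact ⟨j, fun _ => ⟨hj, hne⟩⟩
    · exact ⟨i, fun h' => absurd h' h⟩
  choose j hj using hex
  -- The sign of z i decides which block comes first, so that z i (x - x') is bounded below by a
  -- positive gap.
  set A₁ : ι → Set ℤ := fun i => if 0 < z i then N₁ else N₂ with hA₁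
  set A₂ : ι → Set ℤ := fun i => if 0 < z i then N₂ else N₁ with hA₂
  set B₁ : ι → Set ℤ := fun i => if 0 < z i then M₁ else M₂ with hB₁
  set B₂ : ι → Set ℤ := fun i => if 0 < z i then M₂ else M₁ with hB₂
  have hmul : ∀ i ∈ S, ∀ (U₁ U₂ : Set ℤ) (t : ℤ), 0 ≤ t → (∀ x ∈ U₁, ∀ x' ∈ U₂, t ≤ x - x') →
      ∀ x ∈ (if 0 < z i then U₁ else U₂), ∀ x' ∈ (if 0 < z i then U₂ else U₁),
        t ≤ z i * (x - x') := by
    intro i hiS U₁ U₂ t ht h x hx x' hx'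
    split_ifs at hx hx' with h0
    · have := h x hx x' hx'
      nlinarith
    · have := h x' hx' x hx
      have : z i < 0 := lt_of_le_of_ne (not_lt.1 h0) (hz i hiS)
      nlinarith
  set E : ι → Set Ω := fun i =>
    {ω | (fun k : ((S.erase i).erase (j i) : Finset ι) => e k ω) ∈
        {g : ((S.erase i).erase (j i) : Finset ι) → ℤ |
          ∀ k : ((S.erase i).erase (j i) : Finset ι), (k : ι) < i → g k ∉ N₁ ∪ N₂} ∧
      ((e i ω ∈ A₁ i ∧ e (j i) ω ∈ B₁ (j i)) ∨ (e i ω ∈ A₂ i ∧ e (j i) ω ∈ B₂ (j i))) ∧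
      c + ∑ k ∈ S, z k * e k ω ∉ w} with hE
  have hEm : ∀ i, MeasurableSet (E i) := by
    intro i
    have h1 : Measurable fun ω (k : ((S.erase i).erase (j i) : Finset ι)) => e k ω :=
      measurable_pi_lambda _ fun k => hm k
    have h2 : Measurable fun ω => c + ∑ k ∈ S, z k * e k ω := by fun_prop
    have h3 : ∀ A B : Set ℤ, MeasurableSet {ω | e i ω ∈ A ∧ e (j i) ω ∈ B} := fun A B =>
      (hm i MeasurableSet.of_discrete).inter (hm (j i) MeasurableSet.of_discrete)
    exact (h1 (MeasurableSet.of_discrete (s :=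
      {g | ∀ k : ((S.erase i).erase (j i) : Finset ι), (k : ι) < i → g k ∉ N₁ ∪ N₂}))).inter
        (((h3 _ _).union (h3 _ _)).inter (h2 (MeasurableSet.of_discrete (s := wᶜ))))
  have hEN : ∀ i ∈ S, ∀ ω ∈ E i, e i ω ∈ N₁ ∪ N₂ := by
    rintro i - ω ⟨-, ⟨h, -⟩ | ⟨h, -⟩, -⟩ <;>
    · simp only [hA₁, hA₂] at h
      split_ifs at h <;> simp [h]
  -- The partner may precede i, but it lies in M₁ ∪ M₂, which is disjoint from N₁ ∪ N₂; hence the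
  -- events are pairwise disjoint.
  have hEM : ∀ i ∈ S, ∀ ω ∈ E i, ∀ k ∈ S, k < i → e k ω ∉ N₁ ∪ N₂ := by
    rintro i hiS ω ⟨h, h', -⟩ k hkS hki
    by_cases hkj : k = j i
    · have : e (j i) ω ∈ M₁ ∪ M₂ := by
        rcases h' with ⟨-, h'⟩ | ⟨-, h'⟩ <;>
        · simp only [hB₁, hB₂] at h'
          split_ifs at h' <;> simp [h']
      rw [hkj]
      exact fun hN => Set.disjoint_left.1 hNM hN this
    · exact h ⟨k, Finset.mem_erase.2 ⟨hkj, Finset.mem_erase.2 ⟨hki.ne, hkS⟩⟩⟩ hki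
  have hdisj : (S : Set ι).PairwiseDisjoint E := by
    intro i hiS k hkS hik
    refine Set.disjoint_left.2 fun ω h h' => ?_
    rcases lt_or_gt_of_ne hik with hlt | hlt
    · exact hEM k hkS ω h' i hiS hlt (hEN i hiS ω h)
    · exact hEM i hiS ω h k hkS hlt (hEN k hkS ω h')
  have hlow : ∀ i ∈ S, (∏ k ∈ S with k < i, (1 - ν)) * (β * μ) ≤ P.real (E i) := by
    intro i hiS
    have hAB := mul_le_measureReal_notMem hm hi z c hiS (hj i hiS).1 (hj i hiS).2.symm hw
      (A₁ := A₁ i) (A₂ := A₂ i) (B₁ := B₁ (j i)) (B₂ := B₂ (j i)) (β := β * μ)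
      (fun x hx x' hx' y hy y' hy' => hab.trans (add_le_add (hmul i hiS N₁ N₂ a ha hN x hx x' hx')
        (hmul (j i) (hj i hiS).1 M₁ M₂ b hb hM y hy y' hy')))
      (by
        simp only [hA₁, hB₁]
        split_ifs <;> exact mul_le_mul (by first | exact hN₁ i | exact hN₂ i)
          (by first | exact hM₁ _ | exact hM₂ _) hμ measureReal_nonneg)
      (by
        simp only [hA₂, hB₂]
        split_ifs <;> exact mul_le_mul (by first | exact hN₁ i | exact hN₂ i)
          (by first | exact hM₁ _ | exact hM₂ _) hμ measureReal_nonneg)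
      rfl {g : ((S.erase i).erase (j i) : Finset ι) → ℤ |
        ∀ k : ((S.erase i).erase (j i) : Finset ι), (k : ι) < i → g k ∉ N₁ ∪ N₂}
    refine le_trans (mul_le_mul_of_nonneg_right ?_ (mul_nonneg hβ hμ)) hAB
    have hprod : P.real (⋂ k ∈ S.filter (· < i), e k ⁻¹' (N₁ ∪ N₂)ᶜ)
        = ∏ k ∈ S with k < i, (1 - ν) := by
      have h1 := hi.measure_inter_preimage_eq_mul (S.filter (· < i)) (sets := fun _ => (N₁ ∪ N₂)ᶜ)
        (fun _ _ => MeasurableSet.of_discrete)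
      rw [measureReal_def, h1, ENNReal.toReal_prod]
      refine Finset.prod_congr rfl fun k _ => ?_
      rw [← measureReal_def, Set.preimage_compl, probReal_compl_eq_one_sub (hm k MeasurableSet.of_discrete)]
      congr 1
      exact hν k
    rw [← hprod]
    refine measureReal_mono ?_
    intro ω hω k hki
    simp only [Set.mem_iInter, Finset.mem_filter] at hω
    exact hω k ⟨(Finset.mem_erase.1 (Finset.mem_erase.1 k.2).2).2, hki⟩
  have hsum : ∑ i ∈ S, P.real (E i) ≤ P.real {ω | c + ∑ k ∈ S, z k * e k ω ∉ w} := by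
    rw [← measureReal_biUnion_finset hdisj fun i _ => hEm i]
    refine measureReal_mono ?_
    intro ω hω
    obtain ⟨i, -, hω⟩ := Set.mem_iUnion₂.1 hω
    exact hω.2.2
  have hid := Finset.prod_one_sub_ordered S (fun _ : ι => ν)
  rw [Finset.prod_const] at hid
  rw [hid, sub_sub_cancel]
  calc β * μ * ∑ i ∈ S, ν * ∏ k ∈ S with k < i, (1 - ν)
      = ν * ∑ i ∈ S, (∏ k ∈ S with k < i, (1 - ν)) * (β * μ) := by
        rw [Finset.mul_sum, Finset.mul_sum]
        exact Finset.sum_congr rfl fun _ _ => by ring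
    _ ≤ ν * P.real {ω | c + ∑ k ∈ S, z k * e k ω ∉ w} :=
        mul_le_mul_of_nonneg_left ((Finset.sum_le_sum hlow).trans hsum) hν0

end

/-! ### Gaussian sums over ℤ_q and their tails. -/

/-- `ℤ_q` as a finite set. -/
noncomputable def zqFinset (q : ℕ) : Finset ℤ := Finset.Ico (-((q : ℤ) / 2)) (q - (q : ℤ) / 2)

theorem coe_zqFinset (q : ℕ) : (zqFinset q : Set ℤ) = ZqSet q := by
  ext x
  simp only [zqFinset, Finset.coe_Ico, Set.mem_Ico, ZqSet, Set.mem_ofPred_eq]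
  have h1 : (-(q : ℝ) / 2 ≤ (x : ℝ)) ↔ -(q : ℤ) ≤ 2 * x := by
    rw [div_le_iff₀ two_pos]
    constructor
    · intro h
      have : ((-(q : ℤ) : ℤ) : ℝ) ≤ ((x * 2 : ℤ) : ℝ) := by push_cast; exact h
      have := Int.cast_le.1 this
      omega
    · intro h
      have : ((-(q : ℤ) : ℤ) : ℝ) ≤ ((2 * x : ℤ) : ℝ) := Int.cast_le.2 h
      push_cast at this
      linarith
  have h2 : ((x : ℝ) < (q : ℝ) / 2) ↔ 2 * x < (q : ℤ) := by
    rw [lt_div_iff₀ two_pos]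
    constructor
    · intro h
      have : ((x * 2 : ℤ) : ℝ) < ((q : ℤ) : ℝ) := by push_cast; exact h
      have := Int.cast_lt.1 this
      omega
    · intro h
      have : ((2 * x : ℤ) : ℝ) < ((q : ℤ) : ℝ) := Int.cast_lt.2 h
      push_cast at this
      linarith
  rw [h1, h2]
  omega

theorem mem_zqFinset {q : ℕ} {x : ℤ} : x ∈ zqFinset q ↔ x ∈ ZqSet q := by
  rw [← coe_zqFinset, Finset.mem_coe]

theorem card_zqFinset (q : ℕ) : (zqFinset q).card = q := by
  rw [zqFinset, Int.card_Ico]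
  omega

theorem tsum_ZqSet (q : ℕ) (f : ℤ → ℝ) : ∑' x : ZqSet q, f x = ∑ x ∈ zqFinset q, f x := by
  rw [← coe_zqFinset]
  exact Finset.tsum_subtype' (zqFinset q) f

/-- The normalizing constant of `N_{ℤ_q}(0, σ²)`. -/
noncomputable def zqGaussSum (σ : ℝ) (q : ℕ) : ℝ :=
  ∑ x ∈ zqFinset q, Real.exp (-(x : ℝ) ^ 2 / (2 * σ ^ 2))

theorem zqGaussSum_pos (σ : ℝ) {q : ℕ} (hq : 0 < q) : 0 < zqGaussSum σ q :=
  Finset.sum_pos (fun _ _ => Real.exp_pos _) (Finset.card_pos.1 (by rwa [card_zqFinset]))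

theorem zqGaussSum_le_card (σ : ℝ) (q : ℕ) : zqGaussSum σ q ≤ q := by
  refine (Finset.sum_le_card_nsmul _ _ 1 fun x _ => ?_).trans (by simp [card_zqFinset])
  rw [Real.exp_le_one_iff]
  exact div_nonpos_of_nonpos_of_nonneg (by nlinarith [sq_nonneg (x : ℝ)]) (by positivity)

theorem zqGaussSum_le {σ : ℝ} (hσ : 1 / 2 ≤ σ) (q : ℕ) : zqGaussSum σ q ≤ 6 * σ := by
  have hpi := Real.pi_gt_three
  have hσ0 : 0 < σ := by linarith
  have hsum : Summable fun x : ℤ => Real.exp (-(x : ℝ) ^ 2 / (2 * σ ^ 2)) := by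
    simpa using summable_exp_neg_add_sq (V := σ ^ 2) (by positivity) 0
  have h1 : Real.exp (-(2 * Real.pi ^ 2 * σ ^ 2)) ≤ 1 / 4 := by
    have h4 : (9 : ℝ) ≤ Real.pi ^ 2 := by nlinarith
    have h5 : (1 / 4 : ℝ) ≤ σ ^ 2 := by nlinarith
    have h2 : (4 : ℝ) ≤ 2 * Real.pi ^ 2 * σ ^ 2 := by nlinarith
    have h3 := Real.add_one_le_exp (2 * Real.pi ^ 2 * σ ^ 2)
    rw [Real.exp_neg]
    refine inv_le_of_inv_le₀ (by norm_num) ?_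
    norm_num
    linarith
  have h2 := tsum_exp_neg_add_sq_le (V := σ ^ 2) (by positivity) 0 (h1.trans (by norm_num))
  simp only [add_zero] at h2
  refine (hsum.sum_le_tsum _ fun _ _ => (Real.exp_pos _).le).trans (h2.trans ?_)
  -- The constant 6 is 3 · 2, from √(2π) ≤ 3 and 1 + 4 · (1/4) = 2.
  have h3 : Real.sqrt (2 * Real.pi * σ ^ 2) ≤ 3 * σ := by
    rw [Real.sqrt_le_left (by positivity)]
    nlinarith [Real.pi_lt_four, sq_nonneg σ]
  have h4 := Real.sqrt_nonneg (2 * Real.pi * σ ^ 2)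
  nlinarith

/-- The part of a Gaussian sum beyond the block of the last `w` points of a window is at most the
sum over this block. -/
theorem tsum_tail_le_sum_block {σ : ℝ} (hσ : 0 < σ) {w : ℕ} (hw : σ ≤ w) {a : ℤ} (ha : (w : ℤ) ≤ a) :
    ∑' n : ℕ, Real.exp (-((a + w + n : ℤ) : ℝ) ^ 2 / (2 * σ ^ 2))
      ≤ ∑ n ∈ Finset.range w, Real.exp (-((a + n : ℤ) : ℝ) ^ 2 / (2 * σ ^ 2)) := by
  have hsum : Summable fun x : ℤ => Real.exp (-(x : ℝ) ^ 2 / (2 * σ ^ 2)) := by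
    simpa using summable_exp_neg_add_sq (V := σ ^ 2) (by positivity) 0
  have hs1 : Summable fun n : ℕ => Real.exp (-((a + n : ℤ) : ℝ) ^ 2 / (2 * σ ^ 2)) :=
    hsum.comp_injective (i := fun n : ℕ => a + (n : ℤ)) fun n n' h => by simpa using h
  have hs2 : Summable fun n : ℕ => Real.exp (-((a + w + n : ℤ) : ℝ) ^ 2 / (2 * σ ^ 2)) :=
    hsum.comp_injective (i := fun n : ℕ => a + w + (n : ℤ)) fun n n' h => by simpa using h
  have hsplit := hs1.sum_add_tsum_nat_add w
  have hshift : ∑' n : ℕ, Real.exp (-((a + (n + w : ℕ) : ℤ) : ℝ) ^ 2 / (2 * σ ^ 2))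
      = ∑' n : ℕ, Real.exp (-((a + w + n : ℤ) : ℝ) ^ 2 / (2 * σ ^ 2)) := by
    refine tsum_congr fun n => ?_
    congr 3
    push_cast
    ring
  -- Moving by w ≥ σ at a distance of at least w from 0 costs a factor of at most e⁻¹ ≤ 1/2. So the
  -- tail is at most half of block plus tail.
  have hhalf : ∑' n : ℕ, Real.exp (-((a + w + n : ℤ) : ℝ) ^ 2 / (2 * σ ^ 2))
      ≤ 1 / 2 * ∑' n : ℕ, Real.exp (-((a + n : ℤ) : ℝ) ^ 2 / (2 * σ ^ 2)) := by
    rw [← tsum_mul_left]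
    refine hs2.tsum_le_tsum (fun n => ?_) (hs1.mul_left _)
    have h1 : Real.exp (-1) ≤ 1 / 2 := by
      rw [Real.exp_neg]
      refine inv_le_of_inv_le₀ (by norm_num) ?_
      norm_num
      linarith [Real.add_one_le_exp (1 : ℝ)]
    refine le_trans ?_ (mul_le_mul_of_nonneg_right h1 (Real.exp_pos _).le)
    rw [← Real.exp_add, Real.exp_le_exp]
    push_cast
    have ha' : (w : ℝ) ≤ a := by exact_mod_cast ha
    have hn : (0 : ℝ) ≤ n := n.cast_nonneg
    rw [div_le_iff₀ (by positivity), add_mul, div_mul_cancel₀ _ (by positivity)]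
    nlinarith [mul_nonneg (sub_nonneg.2 ha') (hσ.le.trans hw), mul_nonneg hn (hσ.le.trans hw),
      mul_self_le_mul_self hσ.le hw]
  rw [hshift] at hsplit
  linarith

/-- The Gaussian sum over the integers exceeds the sum over `ℤ_q` by at most two tails. -/
theorem sqrt_le_zqGaussSum_add {σ : ℝ} (hσ : 0 < σ) (q : ℕ) :
    σ * Real.sqrt (2 * Real.pi) ≤ zqGaussSum σ q +
      2 * ∑' n : ℕ, Real.exp (-(((q : ℤ) - (q : ℤ) / 2 + n : ℤ) : ℝ) ^ 2 / (2 * σ ^ 2)) := by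
  have hpi := Real.pi_pos
  set f : ℤ → ℝ := fun x => Real.exp (-(x : ℝ) ^ 2 / (2 * σ ^ 2)) with hf
  have hf0 : ∀ x, 0 < f x := fun _ => Real.exp_pos _
  have hsum : Summable f := by
    simpa using summable_exp_neg_add_sq (V := σ ^ 2) (by positivity) 0
  -- The first integer beyond ℤ_q on the right. Reflecting the left complement also lands in [b, ∞),
  -- so two copies of this tail suffice for both parities of q.
  set b : ℤ := (q : ℤ) - (q : ℤ) / 2 with hb
  have hinj : Function.Injective fun n : ℕ => b + (n : ℤ) := fun n n' h => by simpa using h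
  set g : ℤ → ℝ := fun x => if b ≤ x then f x else 0 with hg
  have hgsum : HasSum g (∑' n : ℕ, f (b + n)) := by
    have h1 : HasSum (g ∘ fun n : ℕ => b + (n : ℤ)) (∑' n : ℕ, f (b + n)) := by
      have : (g ∘ fun n : ℕ => b + (n : ℤ)) = fun n : ℕ => f (b + n) := by
        funext n
        simp [hg]
      rw [this]
      exact (hsum.comp_injective hinj).hasSum
    refine (hinj.hasSum_iff fun x hx => ?_).1 h1
    simp only [hg]
    rw [if_neg]
    intro hbx
    exact hx ⟨(x - b).toNat, by simp only; omega⟩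
  have hgneg : HasSum (fun x => g (-x)) (∑' n : ℕ, f (b + n)) := by
    have h1 : HasSum (g ∘ Equiv.neg ℤ) (∑' n : ℕ, f (b + n)) :=
      (Equiv.hasSum_iff (Equiv.neg ℤ)).2 hgsum
    have h2 : (g ∘ Equiv.neg ℤ) = fun x => g (-x) := funext fun x => by
      rw [Function.comp_apply, Equiv.neg_apply]
    rwa [h2] at h1
  have hz : HasSum (fun x => if x ∈ zqFinset q then f x else 0) (zqGaussSum σ q) := by
    have h1 : HasSum (fun x => if x ∈ zqFinset q then f x else 0)
        (∑ x ∈ zqFinset q, if x ∈ zqFinset q then f x else 0) :=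
      hasSum_sum_of_ne_finset_zero fun x hx => if_neg hx
    rwa [Finset.sum_congr rfl fun x hx => if_pos hx] at h1
  have hg0 : ∀ x, 0 ≤ g x := fun x => by
    simp only [hg]
    split_ifs
    exacts [(hf0 x).le, le_rfl]
  have hpt : ∀ x, f x ≤ (if x ∈ zqFinset q then f x else 0) + g x + g (-x) := by
    intro x
    by_cases hx : x ∈ zqFinset q
    · rw [if_pos hx]
      linarith [hg0 x, hg0 (-x)]
    · rw [if_neg hx]
      simp only [zqFinset, Finset.mem_Ico, not_and_or, not_le, not_lt] at hx
      rcases hx with hx | hx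
      · have h1 : g (-x) = f x := by
          simp only [hg, hf]
          rw [if_pos (by omega)]
          congr 2
          push_cast
          ring
        linarith [hg0 x]
      · have h1 : g x = f x := by
          simp only [hg]
          rw [if_pos hx]
        linarith [hg0 (-x)]
  have hle := hasSum_le hpt hsum.hasSum ((hz.add hgsum).add hgneg)
  have h1 := sqrt_le_tsum_exp_neg_sq (V := σ ^ 2) (by positivity)
  rw [Real.sqrt_mul (by positivity), Real.sqrt_sq hσ.le] at h1
  have h2 : ∑' n : ℕ, Real.exp (-((b + n : ℤ) : ℝ) ^ 2 / (2 * σ ^ 2)) = ∑' n : ℕ, f (b + n) := rfl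
  have h3 : ∑' x : ℤ, Real.exp (-(x : ℝ) ^ 2 / (2 * σ ^ 2)) = ∑' x : ℤ, f x := rfl
  rw [h2]
  rw [h3] at h1
  linarith

/-! ### Small overflow probability makes truncation harmless. -/

/-- A lower bound for the overflow probability of a combination of at least two truncated discrete
Gaussians whose standard deviation is of the order of the modulus. -/
noncomputable def overflowConst : ℝ := (Real.exp (-56) / 8) ^ 2

theorem overflowConst_pos : 0 < overflowConst := by
  unfold overflowConst
  positivity

section
variable {Ω : Type*} [MeasurableSpace Ω] {P : Measure Ω} [IsProbabilityMeasure P]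

theorem measureReal_mem_finset {E : Ω → ℤ} (hm : Measurable E) {σ : ℝ} {q : ℕ}
    (hE : ∀ x ∈ zqFinset q, P.real {ω | E ω = x}
      = Real.exp (-(x : ℝ) ^ 2 / (2 * σ ^ 2)) / zqGaussSum σ q)
    {T : Finset ℤ} (hT : T ⊆ zqFinset q) :
    P.real {ω | E ω ∈ (T : Set ℤ)}
      = (∑ x ∈ T, Real.exp (-(x : ℝ) ^ 2 / (2 * σ ^ 2))) / zqGaussSum σ q := by
  have h1 := sum_measureReal_preimage_singleton (μ := P) (f := E) T
    (fun y _ => hm (measurableSet_singleton y))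
  rw [Finset.sum_div, ← Finset.sum_congr rfl fun x hx => hE x (hT hx)]
  exact h1.symm

theorem sub_lt_of_mem_ZqSet {q : ℕ} : ∀ v ∈ ZqSet q, ∀ v' ∈ ZqSet q, v - v' < (q : ℤ) := by
  intro v hv v' hv'
  rw [← mem_zqFinset, zqFinset, Finset.mem_Ico] at hv hv'
  omega

/-- When σ is at least of the order of q, the blocks at both ends of ℤ_q have probability bounded
below. Two summands in end blocks chosen by sign, versus the opposite blocks, give sums at least q
apart. -/
theorem overflowConst_le_measureReal {n : ℕ} {e : Fin n → Ω → ℤ} (hm : ∀ i, Measurable (e i))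
    (hi : iIndepFun e P) {σ : ℝ} (hσ : 0 < σ) {q : ℕ} (hq : 2 ≤ q) (hqσ : (q : ℝ) ≤ 21 * σ)
    (he : ∀ i, ∀ x ∈ zqFinset q, P.real {ω | e i ω = x}
      = Real.exp (-(x : ℝ) ^ 2 / (2 * σ ^ 2)) / zqGaussSum σ q)
    (z : Fin n → ℤ) (c : ℤ) {S : Finset (Fin n)} (hS : S.Nontrivial) (hz : ∀ i ∈ S, z i ≠ 0) :
    overflowConst ≤ P.real {ω | c + ∑ k ∈ S, z k * e k ω ∉ ZqSet q} := by
  obtain ⟨i, hiS, j, hjS, hij⟩ := hS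
  -- The largest k for which two end blocks of k + 1 points satisfy 2(x - x') ≥ q; still k + 1 ≥
  -- q/8.
  set k : ℕ := (q - 2) / 4 with hk
  set T : Finset ℤ := Finset.Ico ((q : ℤ) - (q : ℤ) / 2 - (k + 1)) (q - (q : ℤ) / 2) with hT
  set B : Finset ℤ := Finset.Ico (-((q : ℤ) / 2)) (-((q : ℤ) / 2) + (k + 1)) with hB
  have hTq : T ⊆ zqFinset q := Finset.Ico_subset_Ico (by omega) le_rfl
  have hBq : B ⊆ zqFinset q := Finset.Ico_subset_Ico le_rfl (by omega)
  have hTc : T.card = k + 1 := by rw [hT, Int.card_Ico]; omega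
  have hBc : B.card = k + 1 := by rw [hB, Int.card_Ico]; omega
  have hq0 : (0 : ℝ) < q := by
    have : 0 < q := by omega
    exact_mod_cast this
  have hprob : ∀ U : Finset ℤ, U ⊆ zqFinset q → U.card = k + 1 → ∀ i,
      Real.exp (-56) / 8 ≤ P.real {ω | e i ω ∈ (U : Set ℤ)} := by
    intro U hU hUc i
    rw [measureReal_mem_finset (hm i) (he i) hU]
    -- |x| ≤ q/2 and q ≤ 21σ give x²/(2σ²) ≤ 441/8 < 56.
    have h1 : ∀ x ∈ U, Real.exp (-56) ≤ Real.exp (-(x : ℝ) ^ 2 / (2 * σ ^ 2)) := by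
      intro x hx
      rw [Real.exp_le_exp, le_div_iff₀ (by positivity)]
      obtain ⟨h2, h3⟩ := mem_zqFinset.1 (hU hx)
      have h4 : (x : ℝ) ^ 2 ≤ ((q : ℝ) / 2) ^ 2 := by
        rw [sq_le_sq, abs_of_nonneg (by positivity : (0 : ℝ) ≤ q / 2), abs_le]
        constructor <;> linarith
      nlinarith [mul_self_le_mul_self hq0.le hqσ]
    have h2 := Finset.card_nsmul_le_sum U _ _ h1
    rw [hUc, nsmul_eq_mul] at h2
    have h3 : (q : ℝ) ≤ 8 * ((k + 1 : ℕ) : ℝ) := by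
      have : q ≤ 8 * (k + 1) := by omega
      exact_mod_cast this
    rw [div_le_div_iff₀ (by norm_num) (zqGaussSum_pos σ (by omega))]
    have h4 := zqGaussSum_le_card σ q
    have h5 := Real.exp_pos (-56)
    calc Real.exp (-56) * zqGaussSum σ q ≤ Real.exp (-56) * (8 * ((k + 1 : ℕ) : ℝ)) := by
          gcongr
          exact h4.trans h3
      _ ≤ _ := by linarith
  have hdiff : ∀ x ∈ (T : Set ℤ), ∀ x' ∈ (B : Set ℤ), (q : ℤ) ≤ 2 * (x - x') := by
    intro x hx x' hx'
    simp only [hT, hB, Finset.coe_Ico, Set.mem_Ico] at hx hx'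
    omega
  have hmul : ∀ i ∈ S, ∀ x ∈ (if 0 < z i then (T : Set ℤ) else B),
      ∀ x' ∈ (if 0 < z i then (B : Set ℤ) else T), (q : ℤ) ≤ 2 * (z i * (x - x')) := by
    intro i hiS x hx x' hx'
    split_ifs at hx hx' with h0
    · have := hdiff x hx x' hx'
      nlinarith
    · have := hdiff x' hx' x hx
      have : z i < 0 := lt_of_le_of_ne (not_lt.1 h0) (hz i hiS)
      nlinarith
  have h8 : (0 : ℝ) ≤ Real.exp (-56) / 8 := by positivity
  have h := mul_le_measureReal_notMem hm hi z c hiS hjS hij (sub_lt_of_mem_ZqSet (q := q))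
    (A₁ := if 0 < z i then (T : Set ℤ) else B) (A₂ := if 0 < z i then (B : Set ℤ) else T)
    (B₁ := if 0 < z j then (T : Set ℤ) else B) (B₂ := if 0 < z j then (B : Set ℤ) else T)
    (β := overflowConst)
    (fun x hx x' hx' y hy y' hy' => by
      have h1 := hmul i hiS x hx x' hx'
      have h2 := hmul j hjS y hy y' hy'
      linarith)
    (by
      rw [overflowConst, sq]
      split_ifs <;> exact mul_le_mul (by first | exact hprob T hTq hTc i | exact hprob B hBq hBc i)
        (by first | exact hprob T hTq hTc j | exact hprob B hBq hBc j) h8 measureReal_nonneg)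
    (by
      rw [overflowConst, sq]
      split_ifs <;> exact mul_le_mul (by first | exact hprob T hTq hTc i | exact hprob B hBq hBc i)
        (by first | exact hprob T hTq hTc j | exact hprob B hBq hBc j) h8 measureReal_nonneg)
    rfl Set.univ
  simp only [Set.mem_univ, true_and, Set.ofPred_true, probReal_univ, one_mul] at h
  refine h.trans (measureReal_mono ?_)
  exact fun ω hω => hω.2

/-- If the overflow probability is small, then the truncation to `ℤ_q` has little effect on the
normalizing constants. -/
theorem ratio_pow_le {n : ℕ} {e : Fin n → Ω → ℤ} (hm : ∀ i, Measurable (e i))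
    (hi : iIndepFun e P) {σ : ℝ} (hσ : 1 / 2 ≤ σ) {q : ℕ} (hq : 2 ≤ q)
    (he : ∀ i, ∀ x ∈ zqFinset q, P.real {ω | e i ω = x}
      = Real.exp (-(x : ℝ) ^ 2 / (2 * σ ^ 2)) / zqGaussSum σ q)
    (z : Fin n → ℤ) (c : ℤ) {S : Finset (Fin n)} (hS : S.Nontrivial) (hz : ∀ i ∈ S, z i ≠ 0)
    (hp : P.real {ω | c + ∑ k ∈ S, z k * e k ω ∉ ZqSet q} < overflowConst) :
    (σ * Real.sqrt (2 * Real.pi) / zqGaussSum σ q) ^ S.card ≤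
      1 + P.real {ω | c + ∑ k ∈ S, z k * e k ω ∉ ZqSet q} / overflowConst := by
  have hσ0 : 0 < σ := by linarith
  have hpi := Real.pi_pos
  set p := P.real {ω | c + ∑ k ∈ S, z k * e k ω ∉ ZqSet q} with hp_def
  have hp0 : 0 ≤ p := measureReal_nonneg
  set w : ℕ := ⌈σ⌉₊ with hw
  have hσw : σ ≤ w := Nat.le_ceil σ
  have hwσ : (w : ℝ) ≤ 3 * σ := by
    have := Nat.ceil_lt_add_one hσ0.le
    linarith
  have hw1 : 1 ≤ w := Nat.ceil_pos.2 hσ0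
  -- A modulus this small compared with σ forces overflow of constant probability, contrary to `hp`.
  by_cases hqw : q < 7 * w
  · have h1 : (q : ℝ) ≤ 21 * σ := by
      have : (q : ℝ) ≤ 7 * w := by exact_mod_cast hqw.le
      linarith
    exact absurd (overflowConst_le_measureReal hm hi hσ0 hq h1 he z c hS hz) (not_le.2 hp)
  rw [not_lt] at hqw
  have hZ : 0 < zqGaussSum σ q := zqGaussSum_pos σ (by omega)
  set Z := zqGaussSum σ q with hZ_def
  set f : ℤ → ℝ := fun x => Real.exp (-(x : ℝ) ^ 2 / (2 * σ ^ 2)) with hf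
  have hfneg : ∀ x, f (-x) = f x := fun x => by simp [hf]
  set b : ℤ := (q : ℤ) - (q : ℤ) / 2 with hb
  -- N₁ and N₂ = -N₁ are the end blocks, M₁ and M₂ = -M₁ moderate ones. The gaps 2(b - w) and 2(w +
  -- 1) add up to at least q: the M blocks make up for the width of the N blocks. The condition q ≥
  -- 7w keeps them disjoint.
  set N₁ : Finset ℤ := Finset.Ico (b - w) b with hN₁
  set N₂ : Finset ℤ := Finset.Ioc (-b) (-b + w) with hN₂
  set M₁ : Finset ℤ := Finset.Icc (w + 1) (2 * w) with hM₁
  set M₂ : Finset ℤ := Finset.Icc (-(2 * w)) (-(w + 1)) with hM₂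
  have hsub : N₁ ⊆ zqFinset q ∧ N₂ ⊆ zqFinset q ∧ M₁ ⊆ zqFinset q ∧ M₂ ⊆ zqFinset q := by
    refine ⟨?_, ?_, ?_, ?_⟩ <;> intro x hx <;>
    simp only [hN₁, hN₂, hM₁, hM₂, Finset.mem_Ico, Finset.mem_Ioc, Finset.mem_Icc] at hx <;>
    simp only [zqFinset, Finset.mem_Ico] <;> omega
  obtain ⟨hN₁q, hN₂q, hM₁q, hM₂q⟩ := hsub
  have hN₂sum : ∑ x ∈ N₂, f x = ∑ x ∈ N₁, f x := by
    refine Finset.sum_nbij' (fun x => -x) (fun x => -x) ?_ ?_ ?_ ?_ ?_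
    · intro x hx; simp only [hN₁, hN₂, Finset.mem_Ico, Finset.mem_Ioc] at hx ⊢; omega
    · intro x hx; simp only [hN₁, hN₂, Finset.mem_Ico, Finset.mem_Ioc] at hx ⊢; omega
    · intro x _; exact neg_neg x
    · intro x _; exact neg_neg x
    · intro x _; exact (hfneg x).symm
  set β := (∑ x ∈ N₁, f x) / Z with hβ
  have hβ0 : 0 < β := by
    refine div_pos (Finset.sum_pos (fun _ _ => Real.exp_pos _) ⟨b - w, ?_⟩) hZ
    simp only [hN₁, Finset.mem_Ico]
    omega
  have hPN₁ : ∀ i, P.real {ω | e i ω ∈ (N₁ : Set ℤ)} = β := fun i =>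
    measureReal_mem_finset (hm i) (he i) hN₁q
  have hPN₂ : ∀ i, P.real {ω | e i ω ∈ (N₂ : Set ℤ)} = β := fun i => by
    rw [measureReal_mem_finset (hm i) (he i) hN₂q, hβ, ← hN₂sum]
  have hNN : Disjoint N₁ N₂ := by
    rw [Finset.disjoint_left]
    intro x hx hx'
    simp only [hN₁, hN₂, Finset.mem_Ico, Finset.mem_Ioc] at hx hx'
    omega
  have hPN : ∀ i, P.real {ω | e i ω ∈ (N₁ : Set ℤ) ∪ N₂} = 2 * β := fun i => by
    rw [two_mul]
    nth_rewrite 1 [← hPN₁ i]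
    rw [← hPN₂ i]
    refine measureReal_union (s₁ := {ω | e i ω ∈ (N₁ : Set ℤ)}) (s₂ := {ω | e i ω ∈ (N₂ : Set ℤ)})
      (Set.disjoint_left.2 fun ω h h' => ?_) (hm i MeasurableSet.of_discrete)
    exact Finset.disjoint_left.1 hNN h h'
  -- On the M blocks |x| ≤ 2w ≤ 6σ, hence x²/(2σ²) ≤ 18; they have w ≥ σ points, and Z ≤ 6σ.
  set μ := Real.exp (-18) / 6 with hμ
  have hμ0 : 0 < μ := by positivity
  have hprob : ∀ U : Finset ℤ, U ⊆ zqFinset q → U.card = w → (∀ x ∈ U, |x| ≤ 2 * w) → ∀ i,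
      μ ≤ P.real {ω | e i ω ∈ (U : Set ℤ)} := by
    intro U hU hUc hUx i
    rw [measureReal_mem_finset (hm i) (he i) hU]
    have h1 : ∀ x ∈ U, Real.exp (-18) ≤ Real.exp (-(x : ℝ) ^ 2 / (2 * σ ^ 2)) := by
      intro x hx
      rw [Real.exp_le_exp, le_div_iff₀ (by positivity)]
      have h2 : |(x : ℝ)| ≤ 2 * w := by exact_mod_cast hUx x hx
      have h3 : (x : ℝ) ^ 2 ≤ (2 * (3 * σ)) ^ 2 := by
        rw [← sq_abs]
        exact pow_le_pow_left₀ (abs_nonneg _) (by linarith) 2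
      nlinarith
    have h2 := Finset.card_nsmul_le_sum U _ _ h1
    rw [hUc, nsmul_eq_mul] at h2
    rw [hμ, div_le_div_iff₀ (by norm_num) hZ]
    have h4 : Z ≤ 6 * σ := zqGaussSum_le hσ q
    have h5 := Real.exp_pos (-18)
    calc Real.exp (-18) * Z ≤ Real.exp (-18) * (6 * w) := by
          gcongr
          linarith
      _ ≤ _ := by linarith
  have hPM₁ := hprob M₁ hM₁q (by rw [hM₁, Int.card_Icc]; omega) (fun x hx => by
    simp only [hM₁, Finset.mem_Icc] at hx
    rw [abs_le]
    omega)
  have hPM₂ := hprob M₂ hM₂q (by rw [hM₂, Int.card_Icc]; omega) (fun x hx => by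
    simp only [hM₂, Finset.mem_Icc] at hx
    rw [abs_le]
    omega)
  have hmain := mul_one_sub_pow_le_measureReal_notMem hm hi z c hS hz (sub_lt_of_mem_ZqSet (q := q))
    (a := 2 * (b - w)) (b := 2 * (w + 1)) (by omega) (by omega) (by omega)
    (N₁ := (N₁ : Set ℤ)) (N₂ := (N₂ : Set ℤ)) (M₁ := (M₁ : Set ℤ)) (M₂ := (M₂ : Set ℤ))
    (fun x hx x' hx' => by
      simp only [hN₁, hN₂, Finset.coe_Ico, Finset.coe_Ioc, Set.mem_Ico, Set.mem_Ioc] at hx hx'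
      omega)
    (fun x hx x' hx' => by
      simp only [hM₁, hM₂, Finset.coe_Icc, Set.mem_Icc] at hx hx'
      omega)
    (by
      rw [Set.disjoint_left]
      intro x hx hx'
      simp only [hN₁, hN₂, hM₁, hM₂, Finset.coe_Ico, Finset.coe_Ioc, Finset.coe_Icc, Set.mem_union,
        Set.mem_Ico, Set.mem_Ioc, Set.mem_Icc] at hx hx'
      omega)
    hβ0.le hμ0.le (fun i => (hPN₁ i).ge) (fun i => (hPN₂ i).ge) hPM₁ hPM₂ hPN
  rw [← hp_def] at hmain
  have hκ : overflowConst * 4 ≤ μ := by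
    rw [overflowConst, hμ, div_pow, ← Real.exp_nat_mul]
    have : Real.exp (((2 : ℕ) : ℝ) * -56) ≤ Real.exp (-18) := by
      rw [Real.exp_le_exp]; norm_num
    have := Real.exp_pos (-18)
    generalize Real.exp (((2 : ℕ) : ℝ) * -56) = x at *
    generalize Real.exp (-18) = y at *
    norm_num
    linarith
  have hκ0 := overflowConst_pos
  have hpow : 1 - 2 * p / μ ≤ (1 - 2 * β) ^ S.card := by
    have h1 : μ * (1 - (1 - 2 * β) ^ S.card) ≤ 2 * p :=
      le_of_mul_le_mul_left (by linarith) hβ0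
    have h2 : 1 - (1 - 2 * β) ^ S.card ≤ 2 * p / μ := by
      rw [le_div_iff₀ hμ0]; linarith
    linarith
  have hpμ : 2 * p / μ ≤ 1 / 2 := by
    rw [div_le_iff₀ hμ0]
    linarith
  -- Each of the two tails lost by truncation is at most the mass of the end block N₁.
  have hratio : σ * Real.sqrt (2 * Real.pi) / Z ≤ 1 + 2 * β := by
    have h1 := sqrt_le_zqGaussSum_add hσ0 q
    have h2 := tsum_tail_le_sum_block hσ0 hσw (a := b - w) (by omega)
    have h3 : ∑ n ∈ Finset.range w, Real.exp (-((b - w + n : ℤ) : ℝ) ^ 2 / (2 * σ ^ 2))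
        = ∑ x ∈ N₁, f x := by
      refine Finset.sum_nbij' (fun n : ℕ => b - w + (n : ℤ)) (fun x => (x - (b - w)).toNat)
        ?_ ?_ ?_ ?_ ?_
      · intro n hn
        simp only [Finset.mem_range, hN₁, Finset.mem_Ico] at hn ⊢
        omega
      · intro x hx
        simp only [Finset.mem_range, hN₁, Finset.mem_Ico] at hx ⊢
        omega
      · intro n _; simp
      · intro x hx
        simp only [hN₁, Finset.mem_Ico] at hx
        omega
      · intro n _; rfl
    rw [h3, sub_add_cancel] at h2
    rw [div_le_iff₀ hZ, add_mul, one_mul, mul_assoc, hβ, div_mul_cancel₀ _ hZ.ne']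
    linarith
  have h2β : 0 ≤ 1 - 2 * β := by
    obtain ⟨i, -⟩ := hS.nonempty
    have := hPN i ▸ (measureReal_le_one : P.real {ω | e i ω ∈ (N₁ : Set ℤ) ∪ N₂} ≤ 1)
    linarith
  -- The gain 1 + 2β per factor is cancelled by 1 - 2β, whose power is bounded below by `hpow`.
  have hprod : (σ * Real.sqrt (2 * Real.pi) / Z) ^ S.card * (1 - 2 * β) ^ S.card ≤ 1 := by
    rw [← mul_pow]
    refine pow_le_one₀ (by positivity) ?_
    calc _ ≤ (1 + 2 * β) * (1 - 2 * β) := mul_le_mul_of_nonneg_right hratio h2β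
      _ ≤ 1 := by nlinarith
  set r := (σ * Real.sqrt (2 * Real.pi) / Z) ^ S.card with hr
  have hr0 : 0 ≤ r := by positivity
  have h1 : r * (1 - 2 * p / μ) ≤ 1 := (mul_le_mul_of_nonneg_left hpow hr0).trans hprod
  have h2 : r ≤ 1 + 2 * (2 * p / μ) := by
    have h3 : 0 ≤ 2 * p / μ := by positivity
    nlinarith
  refine h2.trans ?_
  have h3 : 2 * (2 * p / μ) = p * (4 / μ) := by ring
  have h4 : 4 / μ ≤ 1 / overflowConst := by
    rw [div_le_div_iff₀ hμ0 hκ0]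
    linarith
  rw [h3, div_eq_mul_one_div p]
  have := mul_le_mul_of_nonneg_left h4 hp0
  linarith

end

/-! ### Centred residues, comparison of laws, and filtering. -/

theorem cmod_of_mem {q : ℕ} {x : ℤ} (hx : x ∈ ZqSet q) : cmod x q = x := by
  rcases Nat.eq_zero_or_pos q with rfl | hq
  · simp [cmod]
  · obtain ⟨k, hk⟩ := dvd_sub_cmod x q
    have h1 := sub_lt_of_mem_ZqSet _ hx _ (cmod_mem x hq)
    have h2 := sub_lt_of_mem_ZqSet _ (cmod_mem x hq) _ hx
    have hq' : (0 : ℤ) < q := by exact_mod_cast hq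
    have h3 : k < 1 := by nlinarith
    have h4 : -1 < k := by nlinarith
    have h5 : k = 0 := by omega
    rw [h5, mul_zero] at hk
    omega

theorem abs_cmod_le {q : ℕ} (hq : 0 < q) (x : ℤ) : |cmod x q| ≤ |x| := by
  by_cases hx : x ∈ ZqSet q
  · rw [cmod_of_mem hx]
  · have h1 := mem_zqFinset.2 (cmod_mem x hq)
    rw [← mem_zqFinset] at hx
    simp only [zqFinset, Finset.mem_Ico] at h1 hx
    rcases abs_cases (cmod x q) with ⟨h2, h3⟩ | ⟨h2, h3⟩ <;>
    rcases abs_cases x with ⟨h4, h5⟩ | ⟨h4, h5⟩ <;> omega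

/-- Reducing x - c modulo q is injective on ℤ_q and never increases the absolute value. -/
theorem sum_exp_shift_le (σ : ℝ) {q : ℕ} (hq : 0 < q) (c : ℤ) :
    ∑ x ∈ zqFinset q, Real.exp (-((x : ℝ) - c) ^ 2 / (2 * σ ^ 2)) ≤ zqGaussSum σ q := by
  have hinj : Set.InjOn (fun x => cmod (x - c) q) (zqFinset q) := by
    intro x hx y hy hxy
    have h1 := dvd_sub_cmod (x - c) q
    have h2 := dvd_sub_cmod (y - c) q
    simp only at hxy
    rw [hxy] at h1
    have h3 : (q : ℤ) ∣ x - y := by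
      have := dvd_sub h1 h2
      ring_nf at this ⊢
      exact this
    have h4 := cmod_eq_of_dvd h3
    rwa [cmod_of_mem (mem_zqFinset.1 hx), cmod_of_mem (mem_zqFinset.1 hy)] at h4
  calc _ ≤ ∑ x ∈ zqFinset q, Real.exp (-((cmod (x - c) q : ℤ) : ℝ) ^ 2 / (2 * σ ^ 2)) := by
        refine Finset.sum_le_sum fun x _ => Real.exp_le_exp.2 ?_
        refine div_le_div_of_nonneg_right (neg_le_neg ?_) (by positivity)
        rw [sq_le_sq]
        have := abs_cmod_le hq (x - c)
        exact_mod_cast this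
    _ = ∑ y ∈ (zqFinset q).image (fun x => cmod (x - c) q),
          Real.exp (-(y : ℝ) ^ 2 / (2 * σ ^ 2)) :=
        (Finset.sum_image (f := fun y : ℤ => Real.exp (-(y : ℝ) ^ 2 / (2 * σ ^ 2))) hinj).symm
    _ ≤ zqGaussSum σ q := by
        refine Finset.sum_le_sum_of_subset_of_nonneg ?_ fun _ _ _ => (Real.exp_pos _).le
        intro y hy
        obtain ⟨x, -, rfl⟩ := Finset.mem_image.1 hy
        exact mem_zqFinset.2 (cmod_mem _ hq)

/-- As both total masses are 1, the distance is the sum of the positive parts of p - p', so an upper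
bound on p suffices. -/
theorem statDist_le_of_le {p p' o : ℤ → ℝ} {T : Finset ℤ} {δ a : ℝ} (hδ : 0 ≤ δ)
    (hp : ∀ x ∉ T, p x = 0) (hp' : ∀ x ∉ T, p' x = 0) (hp'0 : ∀ x, 0 ≤ p' x) (ho : ∀ x, 0 ≤ o x)
    (h1 : ∑ x ∈ T, p x = 1) (h1' : ∑ x ∈ T, p' x = 1) (hle : ∀ x ∈ T, p x ≤ (1 + δ) * p' x + o x)
    (hoa : ∑ x ∈ T, o x ≤ a) : statDist p p' ≤ δ + a := by
  have h2 : ∑' x, |p x - p' x| = ∑ x ∈ T, |p x - p' x| :=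
    tsum_eq_sum fun x hx => by rw [hp x hx, hp' x hx, sub_self, abs_zero]
  have h3 : ∑ x ∈ T, |p x - p' x| ≤ ∑ x ∈ T, (2 * (δ * p' x + o x) - (p x - p' x)) := by
    refine Finset.sum_le_sum fun x hx => ?_
    have h4 := hle x hx
    have h5 := mul_nonneg hδ (hp'0 x)
    have h6 := ho x
    rw [abs_le]
    constructor <;> linarith
  rw [Finset.sum_sub_distrib, ← Finset.mul_sum, Finset.sum_add_distrib, ← Finset.mul_sum,
    Finset.sum_sub_distrib, h1, h1'] at h3
  rw [statDist, h2]
  linarith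

theorem discreteNormal_ZqSet {q : ℕ} (m v : ℝ) {x : ℤ} (hx : x ∈ zqFinset q) :
    discreteNormal (ZqSet q) m v x = Real.exp (-((x : ℝ) - m) ^ 2 / (2 * v)) /
      ∑ y ∈ zqFinset q, Real.exp (-((y : ℝ) - m) ^ 2 / (2 * v)) := by
  rw [discreteNormal, Set.indicator_of_mem (mem_zqFinset.1 hx),
    tsum_ZqSet q fun y => Real.exp (-((y : ℝ) - m) ^ 2 / (2 * v))]

theorem discreteNormal_of_notMem {q : ℕ} (m v : ℝ) {x : ℤ} (hx : x ∉ zqFinset q) :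
    discreteNormal (ZqSet q) m v x = 0 := by
  rw [discreteNormal, Set.indicator_of_notMem (fun h => hx (mem_zqFinset.2 h)), zero_div]

theorem sum_discreteNormal_ZqSet {q : ℕ} (hq : 0 < q) (m v : ℝ) :
    ∑ x ∈ zqFinset q, discreteNormal (ZqSet q) m v x = 1 := by
  rw [Finset.sum_congr rfl fun x hx => discreteNormal_ZqSet m v hx, ← Finset.sum_div]
  refine div_self (ne_of_gt (Finset.sum_pos (fun _ _ => Real.exp_pos _) ?_))
  exact Finset.card_pos.1 (by rwa [card_zqFinset])

theorem discreteNormal_nonneg (S : Set ℤ) (m v : ℝ) (x : ℤ) : 0 ≤ discreteNormal S m v x :=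
  div_nonneg (Set.indicator_nonneg (fun _ _ => (Real.exp_pos _).le) _)
    (tsum_nonneg fun _ => (Real.exp_pos _).le)

/-- The geometric series bounds the product by exp(8u) for every m; the extra factor 1 + 4u comes
from the normalizing constant of the target law. -/
theorem prod_one_add_le {u : ℝ} (hu0 : 0 ≤ u) (hu : u ≤ 1 / 2) (m : ℕ) :
    (∏ k ∈ Finset.range m, (1 + 4 * u ^ (k + 1))) * (1 + 4 * u) ≤ Real.exp (12 * u) := by
  have h1 : ∏ k ∈ Finset.range m, (1 + 4 * u ^ (k + 1))
      ≤ Real.exp (∑ k ∈ Finset.range m, 4 * u ^ (k + 1)) := by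
    rw [Real.exp_sum]
    refine Finset.prod_le_prod (fun _ _ => by positivity) fun k _ => ?_
    linarith [Real.add_one_le_exp (4 * u ^ (k + 1))]
  have h2 : ∑ k ∈ Finset.range m, 4 * u ^ (k + 1) ≤ 8 * u := by
    have hg := hasSum_geometric_of_lt_one hu0 (by linarith : u < 1)
    have h3 := sum_le_hasSum (Finset.range m) (fun k _ => pow_nonneg hu0 k) hg
    have h4 : (1 - u)⁻¹ ≤ 2 := by
      refine inv_le_of_inv_le₀ (by norm_num) ?_
      norm_num
      linarith
    calc _ = 4 * u * ∑ k ∈ Finset.range m, u ^ k := by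
          rw [Finset.mul_sum]
          exact Finset.sum_congr rfl fun k _ => by ring
      _ ≤ 4 * u * 2 := by
          gcongr
          exact h3.trans h4
      _ = 8 * u := by ring
  have h5 : 1 + 4 * u ≤ Real.exp (4 * u) := by linarith [Real.add_one_le_exp (4 * u)]
  calc _ ≤ Real.exp (8 * u) * Real.exp (4 * u) :=
        mul_le_mul (h1.trans (Real.exp_le_exp.2 h2)) h5 (by positivity) (Real.exp_pos _).le
    _ = Real.exp (12 * u) := by rw [← Real.exp_add]; ring_nf

theorem exp_le_one_add_mul {x : ℝ} : Real.exp x ≤ 1 + x * Real.exp x := by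
  have h1 := Real.add_one_le_exp (-x)
  have h2 : Real.exp (-x) * Real.exp x = 1 := by rw [← Real.exp_add]; simp
  nlinarith [Real.exp_pos x]

theorem residualCovariance_quadratic {n n' : ℕ} (σ : ℝ) (Tc : Matrix (Fin n) (Fin n') ℤ)
    (d : Fin n → ℤ) :
    dotProduct (fun k => (d k : ℝ)) ((residualCovariance σ Tc).mulVec fun k => (d k : ℝ))
      = σ ^ 2 * ∑ i, ((Tc.transpose.mulVec d i : ℤ) : ℝ) ^ 2 := by
  have h : (Tc.map (Int.cast : ℤ → ℝ)).transpose.mulVec (fun k => (d k : ℝ))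
      = fun i => ((Tc.transpose.mulVec d i : ℤ) : ℝ) := by
    funext i
    simp [Matrix.mulVec, dotProduct]
  rw [residualCovariance, Matrix.smul_mulVec, dotProduct_smul, ← Matrix.mulVec_mulVec,
    Matrix.dotProduct_mulVec, ← Matrix.mulVec_transpose, h, smul_eq_mul]
  simp [dotProduct, sq]

/-- Modulo q the inner reductions are invisible, and dᵀA ≡ 0 removes both the public part and the
mask dᵀAs. -/
theorem filterCiphertext_lweEncrypt {q : ℕ} (r : ℤ) {n v : ℕ} (s : Fin v → ℤ)
    (A : Matrix (Fin n) (Fin v) ℤ) (m e d : Fin n → ℤ) (hd : d ∈ kerQ q A.transpose) :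
    filterCiphertext q d (lweEncrypt q r s A m e)
      = (0, cmod (r * dotProduct d m + dotProduct d e) q) := by
  have hc : ∀ a : ℤ, (q : ℤ) ∣ cmod a q - a := fun a => by
    rw [← dvd_neg, neg_sub]
    exact dvd_sub_cmod a q
  have hker : ∀ j, (q : ℤ) ∣ Matrix.vecMul d A j := by
    intro j
    have h1 := dvd_sub_cmod (A.transpose.mulVec d j) q
    rw [hd j, sub_zero, Matrix.mulVec_transpose] at h1
    exact h1
  refine Prod.ext ?_ ?_
  · funext j
    change cmod (Matrix.vecMul d (fun k j => cmod (A k j) q) j) q = 0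
    rw [← hd j]
    refine cmod_eq_of_dvd ?_
    rw [Matrix.mulVec_transpose]
    simp only [Matrix.vecMul, dotProduct]
    rw [← Finset.sum_sub_distrib]
    refine Finset.dvd_sum fun k _ => ?_
    rw [← mul_sub]
    exact (hc _).mul_left _
  · change cmod (dotProduct d fun k => cmod (A.mulVec s k + m k * r + e k) q) q = _
    refine cmod_eq_of_dvd ?_
    have h1 : (q : ℤ) ∣ dotProduct d (A.mulVec s) := by
      rw [Matrix.dotProduct_mulVec]
      exact Finset.dvd_sum fun j _ => (hker j).mul_right _
    have h2 : (q : ℤ) ∣ dotProduct d (fun k => cmod (A.mulVec s k + m k * r + e k) q)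
        - dotProduct d (fun k => A.mulVec s k + m k * r + e k) := by
      simp only [dotProduct]
      rw [← Finset.sum_sub_distrib]
      refine Finset.dvd_sum fun k _ => ?_
      rw [← mul_sub]
      exact (hc _).mul_left _
    have h3 : dotProduct d (fun k => A.mulVec s k + m k * r + e k)
        = dotProduct d (A.mulVec s) + (r * dotProduct d m + dotProduct d e) := by
      simp only [dotProduct, Finset.mul_sum, ← Finset.sum_add_distrib]
      exact Finset.sum_congr rfl fun k _ => by ring
    rw [h3] at h2
    obtain ⟨k₁, hk₁⟩ := h1
    obtain ⟨k₂, hk₂⟩ := h2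
    exact ⟨k₁ + k₂, by linear_combination hk₁ + hk₂⟩

/-- From σ²/R ≥ η² and 2π² ≥ 2π, the exponential is at most the square of exp(-πη²). -/
theorem exp_neg_le_half_sq {η R σ ε : ℝ} (hR : 0 < R)
    (hη : 2 * Real.exp (-Real.pi * η ^ 2) ≤ ε) (hσ : R * η ^ 2 ≤ σ ^ 2) :
    Real.exp (-(2 * Real.pi ^ 2 * (σ ^ 2 / R))) ≤ (ε / 2) ^ 2 := by
  have hpi := Real.pi_gt_three
  have h1 : η ^ 2 ≤ σ ^ 2 / R := by rw [le_div_iff₀ hR]; linarith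
  have h2 : Real.exp (-Real.pi * η ^ 2) ≤ ε / 2 := by linarith
  refine le_trans ?_ (pow_le_pow_left₀ (Real.exp_pos _).le h2 2)
  rw [← Real.exp_nat_mul, Real.exp_le_exp]
  push_cast
  have h3 : Real.pi ≤ Real.pi ^ 2 := by nlinarith
  have h4 : Real.pi * η ^ 2 ≤ Real.pi ^ 2 * (σ ^ 2 / R) :=
    mul_le_mul h3 h1 (sq_nonneg _) (by positivity)
  linarith

/-- If σ < 1/2, then η² < 1/8 and exp(-πη²) ≥ 1 - π/8 > 1/2, which contradicts ε < 1. -/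
theorem half_le_of_smoothing {η R σ ε : ℝ} (hR : 2 ≤ R) (hε1 : ε < 1)
    (hη : 2 * Real.exp (-Real.pi * η ^ 2) ≤ ε) (hσ : R * η ^ 2 ≤ σ ^ 2) (hσ0 : 0 < σ) :
    1 / 2 ≤ σ := by
  by_contra! h
  have h1 := Real.add_one_le_exp (-Real.pi * η ^ 2)
  have h2 : η ^ 2 < 1 / 8 := by nlinarith [sq_nonneg η]
  have h3 := Real.pi_lt_four
  nlinarith [Real.pi_pos, sq_nonneg η]

/-! ### The law of the filtered residual. -/

section
variable {Ω : Type*} [MeasurableSpace Ω] {P : Measure Ω} [IsProbabilityMeasure P]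

/-- The distance of a reduced integer variable `cmod Y q` to a distribution on `ℤ_q`, from a
pointwise bound for the mass function of `Y`. -/
theorem statDist_cmod_le {Y : Ω → ℤ} (hY : Measurable Y) {q : ℕ} (hq : 0 < q) (m v : ℝ) {δ : ℝ}
    (hδ : 0 ≤ δ) (hle : ∀ x ∈ zqFinset q,
      P.real {ω | Y ω = x} ≤ (1 + δ) * discreteNormal (ZqSet q) m v x) :
    statDist (massFunction P fun ω => cmod (Y ω) q) (discreteNormal (ZqSet q) m v)
      ≤ δ + P.real {ω | Y ω ∉ ZqSet q} := by
  have hX : Measurable fun ω => cmod (Y ω) q := (Measurable.of_discrete (f := fun y => cmod y q)).comp hY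
  have hsum : ∀ {Z : Ω → ℤ}, Measurable Z →
      ∑ x ∈ zqFinset q, P.real {ω | Z ω = x} = P.real {ω | Z ω ∈ (zqFinset q : Set ℤ)} :=
    fun {Z} hZ => sum_measureReal_preimage_singleton (μ := P) (f := Z) (zqFinset q)
      (fun y _ => hZ (measurableSet_singleton y))
  have hXmem : ∀ ω, cmod (Y ω) q ∈ zqFinset q := fun ω => mem_zqFinset.2 (cmod_mem _ hq)
  have hX1 : ∑ x ∈ zqFinset q, massFunction P (fun ω => cmod (Y ω) q) x = 1 := by
    refine (hsum hX).trans ?_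
    have : {ω | cmod (Y ω) q ∈ (zqFinset q : Set ℤ)} = Set.univ :=
      Set.eq_univ_of_forall fun ω => hXmem ω
    rw [this, probReal_univ]
  refine statDist_le_of_le (T := zqFinset q)
    -- The mass carried to x by reduction from outside ℤ_q; its total is the overflow probability.
    (o := fun x => massFunction P (fun ω => cmod (Y ω) q) x - P.real {ω | Y ω = x ∧ Y ω ∈ ZqSet q})
    hδ (fun x hx => ?_)
    (fun x hx => discreteNormal_of_notMem _ _ hx) (discreteNormal_nonneg _ _ _) (fun x => ?_) hX1
    (sum_discreteNormal_ZqSet hq _ _) (fun x hx => ?_) ?_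
  · have : {ω | cmod (Y ω) q = x} = ∅ :=
      Set.eq_empty_of_forall_notMem fun ω hω => hx (hω ▸ hXmem ω)
    rw [massFunction, this, measureReal_empty]
  · refine sub_nonneg.2 (measureReal_mono ?_)
    rintro ω ⟨h1, h2⟩
    exact (cmod_of_mem h2).trans h1
  · have h1 : P.real {ω | Y ω = x ∧ Y ω ∈ ZqSet q} ≤ P.real {ω | Y ω = x} :=
      measureReal_mono fun ω hω => hω.1
    have h2 := hle x hx
    linarith
  · have h1 : ∑ x ∈ zqFinset q, P.real {ω | Y ω = x ∧ Y ω ∈ ZqSet q}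
        = ∑ x ∈ zqFinset q, P.real {ω | Y ω = x} := by
      refine Finset.sum_congr rfl fun x hx => ?_
      congr 1
      ext ω
      exact ⟨fun h => h.1, fun h => ⟨h, by
        rw [Set.mem_ofPred_eq] at h
        rw [h]
        exact mem_zqFinset.1 hx⟩⟩
    rw [Finset.sum_sub_distrib, hX1, h1, hsum hY, coe_zqFinset]
    have h2 := probReal_compl_eq_one_sub (μ := P) (hY (MeasurableSet.of_discrete (s := ZqSet q)))
    exact h2.ge

theorem statDist_massFunction_le_one {X : Ω → ℤ} (hX : Measurable X) {q : ℕ} (hq : 0 < q)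
    (hXq : ∀ ω, X ω ∈ ZqSet q) (m v : ℝ) :
    statDist (massFunction P X) (discreteNormal (ZqSet q) m v) ≤ 1 := by
  have hsum : ∑ x ∈ zqFinset q, massFunction P X x = 1 := by
    have h1 := sum_measureReal_preimage_singleton (μ := P) (f := X) (zqFinset q)
      (fun y _ => hX (measurableSet_singleton y))
    refine h1.trans ?_
    have : X ⁻¹' (zqFinset q : Set ℤ) = Set.univ :=
      Set.eq_univ_of_forall fun ω => mem_zqFinset.2 (hXq ω)
    rw [this, probReal_univ]
  have h := statDist_le_of_le (T := zqFinset q) (p := massFunction P X)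
    (p' := discreteNormal (ZqSet q) m v) (o := massFunction P X) (δ := 0) (a := 1) le_rfl
    (fun x hx => by
      have : {ω | X ω = x} = ∅ :=
        Set.eq_empty_of_forall_notMem fun ω hω => hx (hω ▸ mem_zqFinset.2 (hXq ω))
      rw [massFunction, this, measureReal_empty])
    (fun x hx => discreteNormal_of_notMem _ _ hx) (discreteNormal_nonneg _ _ _)
    (fun x => measureReal_nonneg) hsum (sum_discreteNormal_ZqSet hq _ _)
    (fun x _ => by linarith [discreteNormal_nonneg (ZqSet q) m v x]) hsum.le
  linarith

/-- A coefficient ±1 preserves the Gaussian weight exactly, and the shifted normalizing constant is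
at most the centred one, so δ = 0 works and neither smoothing nor a bound on truncation is needed.
-/
theorem statDist_le_of_one_dim {n : ℕ} {e : Fin n → Ω → ℤ} (hm : ∀ i, Measurable (e i))
    {σ : ℝ} {q : ℕ} (hq : 0 < q)
    (he : ∀ i (x : ℤ), P.real {ω | e i ω = x} ≤
      Real.exp (-(x : ℝ) ^ 2 / (2 * σ ^ 2)) / zqGaussSum σ q)
    {a : ℤ} (ha : |a| = 1) (c : ℤ) (i : Fin n) :
    statDist (massFunction P fun ω => cmod (c + a * e i ω) q)
      (discreteNormal (ZqSet q) c (σ ^ 2)) ≤ P.real {ω | c + a * e i ω ∉ ZqSet q} := by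
  have hY : Measurable fun ω => c + a * e i ω := by
    have := hm i
    fun_prop
  have haa : a * a = 1 := by
    rw [← abs_mul_abs_self, ha, one_mul]
  have h := statDist_cmod_le (P := P) hY hq c (σ ^ 2) (le_refl (0 : ℝ)) fun x hx => ?_
  · linarith
  have h1 : {ω | c + a * e i ω = x} ⊆ {ω | e i ω = a * (x - c)} := by
    intro ω hω
    rw [Set.mem_ofPred_eq] at hω ⊢
    rw [← hω, add_sub_cancel_left, ← mul_assoc, haa, one_mul]
  refine (measureReal_mono h1).trans ((he i _).trans ?_)
  rw [discreteNormal_ZqSet _ _ hx, add_zero, one_mul]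
  have h2 : ((a * (x - c) : ℤ) : ℝ) ^ 2 = ((x : ℝ) - c) ^ 2 := by
    have : (a : ℝ) * a = 1 := by exact_mod_cast haa
    push_cast
    linear_combination (((x : ℝ) - c) ^ 2) * this
  rw [h2]
  refine div_le_div_of_nonneg_left (Real.exp_pos _).le ?_ (sum_exp_shift_le σ hq c)
  exact Finset.sum_pos (fun _ _ => Real.exp_pos _) ⟨x, hx⟩

theorem statDist_le_of_nontrivial {n : ℕ} {e : Fin n → Ω → ℤ} (hm : ∀ i, Measurable (e i))
    (hi : iIndepFun e P) {σ : ℝ} (hσ : 1 / 2 ≤ σ) {q : ℕ} (hq : 2 ≤ q)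
    (he : ∀ i, ∀ x ∈ zqFinset q, P.real {ω | e i ω = x}
      = Real.exp (-(x : ℝ) ^ 2 / (2 * σ ^ 2)) / zqGaussSum σ q)
    (he' : ∀ i (x : ℤ), P.real {ω | e i ω = x} ≤
      Real.exp (-(x : ℝ) ^ 2 / (2 * σ ^ 2)) / zqGaussSum σ q)
    (z : Fin n → ℤ) (c : ℤ) {S : Finset (Fin n)} (hS : S.Nontrivial) (hz : ∀ i ∈ S, z i ≠ 0)
    (hgcd : S.gcd z = 1) {ε : ℝ} (hε : 0 < ε) (hε1 : ε < 1)
    (hu : Real.exp (-(2 * Real.pi ^ 2 * (σ ^ 2 / ∑ i ∈ S, (z i : ℝ) ^ 2))) ≤ (ε / 2) ^ 2)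
    (hp : P.real {ω | c + ∑ k ∈ S, z k * e k ω ∉ ZqSet q} < overflowConst) :
    statDist (massFunction P fun ω => cmod (c + ∑ k ∈ S, z k * e k ω) q)
      (discreteNormal (ZqSet q) c (σ ^ 2 * ∑ i ∈ S, (z i : ℝ) ^ 2)) ≤
      P.real {ω | c + ∑ k ∈ S, z k * e k ω ∉ ZqSet q} / overflowConst + 6 * Real.exp 3 * ε +
        P.real {ω | c + ∑ k ∈ S, z k * e k ω ∉ ZqSet q} := by
  have hσ0 : 0 < σ := by linarith
  have hpi := Real.pi_pos
  have hκ := overflowConst_pos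
  have hratio := ratio_pow_le hm hi hσ hq he z c hS hz hp
  have hY : Measurable fun ω => c + ∑ k ∈ S, z k * e k ω := by fun_prop
  set p := P.real {ω | c + ∑ k ∈ S, z k * e k ω ∉ ZqSet q} with hp_def
  have hp0 : 0 ≤ p := measureReal_nonneg
  have hZ : 0 < zqGaussSum σ q := zqGaussSum_pos σ (by omega)
  set Z := zqGaussSum σ q with hZ_def
  set s := ∑ i ∈ S, (z i : ℝ) ^ 2 with hs_def
  set u := Real.exp (-(2 * Real.pi ^ 2 * (σ ^ 2 / s))) with hu_def
  have hu0 : 0 < u := Real.exp_pos _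
  have hu2 : u ≤ 1 / 2 := hu.trans (by nlinarith)
  have hs1 : 1 ≤ s := by
    obtain ⟨i, hiS⟩ := hS.nonempty
    have h1 : (1 : ℝ) ≤ (z i : ℝ) ^ 2 := by
      have : (1 : ℤ) ≤ (z i) ^ 2 := by
        have := sq_pos_of_ne_zero (hz i hiS)
        omega
      exact_mod_cast this
    exact h1.trans (Finset.single_le_sum (f := fun i => (z i : ℝ) ^ 2)
      (fun _ _ => sq_nonneg _) hiS)
  have hs0 : 0 < s := by linarith
  have hV : 0 < σ ^ 2 * s := by positivity
  have hδ : (0 : ℝ) ≤ p / overflowConst + 6 * Real.exp 3 * ε := by positivity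
  refine statDist_cmod_le hY (by omega) c (σ ^ 2 * s) hδ fun x hx => ?_
  set D := ∑ y ∈ zqFinset q, Real.exp (-((y : ℝ) - c) ^ 2 / (2 * (σ ^ 2 * s))) with hD_def
  have hD0 : 0 < D := Finset.sum_pos (fun _ _ => Real.exp_pos _) ⟨x, hx⟩
  have hDle : D ≤ σ * Real.sqrt (2 * Real.pi) * Real.sqrt s * (1 + 4 * u) := by
    have hVu : Real.exp (-(2 * Real.pi ^ 2 * (σ ^ 2 * s))) ≤ u := by
      rw [hu_def, Real.exp_le_exp, neg_le_neg_iff]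
      refine mul_le_mul_of_nonneg_left ?_ (by positivity)
      rw [div_le_iff₀ hs0]
      nlinarith [sq_nonneg σ]
    have h1 := tsum_exp_neg_add_sq_le hV (-(c : ℝ)) (hVu.trans hu2)
    have h2 := (summable_exp_neg_add_sq hV (-(c : ℝ))).sum_le_tsum (zqFinset q)
      fun _ _ => (Real.exp_pos _).le
    have h3 : Real.sqrt (2 * Real.pi * (σ ^ 2 * s)) = σ * Real.sqrt (2 * Real.pi) * Real.sqrt s := by
      rw [Real.sqrt_mul (by positivity), Real.sqrt_mul (sq_nonneg σ), Real.sqrt_sq hσ0.le]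
      ring
    rw [h3] at h1
    refine h2.trans (h1.trans ?_)
    gcongr
  have hbound := measureReal_sum_mul_eq_le hm hi hσ0 hZ he' z hu_def hu2 hS.nonempty hz hs_def.ge
    (x - c)
  rw [← hs_def, hgcd] at hbound
  obtain ⟨m, hmS⟩ : ∃ m, S.card = m + 1 :=
    ⟨S.card - 1, by have := Finset.card_pos.2 hS.nonempty; omega⟩
  rw [hmS] at hratio hbound
  rw [Nat.add_sub_cancel] at hbound
  set A := ∏ k ∈ Finset.range m, (1 + 4 * u ^ (k + 1)) with hA
  have hA0 : 0 < A := Finset.prod_pos fun _ _ => by positivity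
  set ρ := σ * Real.sqrt (2 * Real.pi) / Z with hρ
  have hρ0 : 0 < ρ := by positivity
  set G := Real.exp (-((x : ℝ) - c) ^ 2 / (2 * (σ ^ 2 * s))) with hG
  have hG0 : 0 < G := Real.exp_pos _
  have hset : {ω | c + ∑ k ∈ S, z k * e k ω = x} = {ω | ∑ k ∈ S, z k * e k ω = x - c} := by
    ext ω
    simp only [Set.mem_ofPred_eq]
    omega
  rw [hset, discreteNormal_ZqSet _ _ hx, ← hD_def]
  have hbound' : P.real {ω | ∑ k ∈ S, z k * e k ω = x - c}
      ≤ ρ ^ (m + 1) * (A * (1 + 4 * u)) * (G / D) := by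
    refine hbound.trans ?_
    have h1 : (((x - c : ℤ) : ℝ)) = (x : ℝ) - c := by push_cast; ring
    rw [h1, ← hG]
    have hsq : 0 < Real.sqrt s := Real.sqrt_pos.2 hs0
    have h2 : (Z⁻¹ * ρ ^ m * A * (((1 : ℤ).natAbs : ℝ) / Real.sqrt s)) * G
        = ρ ^ (m + 1) * A * G / (σ * Real.sqrt (2 * Real.pi) * Real.sqrt s) := by
      have hρZ : σ * Real.sqrt (2 * Real.pi) = ρ * Z := by
        rw [hρ, div_mul_cancel₀ _ hZ.ne']
      rw [hρZ, pow_succ]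
      simp only [Int.natAbs_one, Nat.cast_one]
      field_simp
    rw [h2]
    have h3 : 0 < σ * Real.sqrt (2 * Real.pi) * Real.sqrt s := by positivity
    have h4 : ρ ^ (m + 1) * (A * (1 + 4 * u)) * (G / D)
        = ρ ^ (m + 1) * A * G * (1 + 4 * u) / D := by ring
    rw [h4, div_le_div_iff₀ h3 hD0]
    calc ρ ^ (m + 1) * A * G * D
        ≤ ρ ^ (m + 1) * A * G * (σ * Real.sqrt (2 * Real.pi) * Real.sqrt s * (1 + 4 * u)) :=
          mul_le_mul_of_nonneg_left hDle (by positivity)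
      _ = _ := by ring
  refine hbound'.trans (mul_le_mul_of_nonneg_right ?_ (by positivity))
  -- Here 12u ≤ 3ε² ≤ 3ε, and eˣ ≤ 1 + x eˣ makes this linear in ε.
  have hprod : A * (1 + 4 * u) ≤ 1 + 3 * Real.exp 3 * ε := by
    have h1 : 12 * u ≤ 3 * ε := by nlinarith
    refine (prod_one_add_le hu0.le hu2 m).trans ?_
    refine (Real.exp_le_exp.2 h1).trans (exp_le_one_add_mul.trans ?_)
    have h2 : Real.exp (3 * ε) ≤ Real.exp 3 := Real.exp_le_exp.2 (by linarith)
    nlinarith [Real.exp_pos 3]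
  have hpκ : p / overflowConst ≤ 1 := by
    rw [div_le_one hκ]
    exact hp.le
  have h3 : (0 : ℝ) ≤ 3 * Real.exp 3 * ε := by positivity
  calc ρ ^ (m + 1) * (A * (1 + 4 * u)) ≤ (1 + p / overflowConst) * (1 + 3 * Real.exp 3 * ε) :=
        mul_le_mul hratio hprod (by positivity) (by positivity)
    _ ≤ 1 + (p / overflowConst + 6 * Real.exp 3 * ε) := by nlinarith

end

theorem mainTheorem4 (K : ℝ) : ∃ C : ℝ, ∀ (Ω : Type*) [MeasurableSpace Ω] (P : Measure Ω)
    [IsProbabilityMeasure P]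
    -- modulus, message scaling, number of residual entries, of fresh ciphertexts, key length
    (q : ℕ) (_ : 0 < q) (r : ℤ) (_ : 0 < r) (n n' v : ℕ)
    -- secret vector, public matrix and plaintext of the residual, linear map of the controller
    (s : Fin v → ℤ) (Pρ : Matrix (Fin n) (Fin v) ℤ) (ρ : Fin n → ℤ)
    (Tc : Matrix (Fin n) (Fin n') ℤ)
    -- filtering vector
    (d : Fin n → ℤ) (_ : d ∈ kerQ q Pρ.transpose)
    (_ : Finset.univ.gcd (Tc.transpose.mulVec d) = 1)
    -- independent encryption errors, each with the law `N_{ℤ_q}(0, σ²)`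
    (σ : ℝ) (_ : 0 < σ) (e : Fin n' → Ω → ℤ) (_ : ∀ i, Measurable (e i)) (_ : iIndepFun e P)
    (_ : ∀ i, massFunction P (e i) = discreteNormal (ZqSet q) 0 (σ ^ 2))
    -- noise level: large enough for smoothing, small enough to avoid overflow modulo `q`
    (ε : ℝ) (_ : 0 < ε) (_ : ε < 1) (l : ℕ) (L : Submodule ℤ (Fin l → ℤ)) (_ : L ≠ ⊥)
    (_ : ‖realVec (Tc.transpose.mulVec d)‖ ^ 2 * smoothingParameter L ε ^ 2 ≤ σ ^ 2)
    (_ : P.real {ω | r * dotProduct d ρ + dotProduct d (Tc.mulVec fun i => e i ω) ∉ ZqSet q}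
      ≤ K * ε),
    ∃ X : Ω → ℤ,
      (∀ ω, filterCiphertext q d (lweEncrypt q r s Pρ ρ (Tc.mulVec fun i => e i ω))
        = (0, X ω)) ∧
      statDist (massFunction P X)
        (discreteNormal (ZqSet q) ((r * dotProduct d ρ : ℤ) : ℝ)
          (dotProduct (fun k => (d k : ℝ))
            ((residualCovariance σ Tc).mulVec fun k => (d k : ℝ)))) ≤ C * ε := by
  refine ⟨K / overflowConst + K + 6 * Real.exp 3, ?_⟩
  intro Ω _ P _ q hq r hr n n' v s Pρ ρ Tc d hd hgcd σ hσ e hm hi he ε hε hε1 l L hL hsm hover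
  have hκ := overflowConst_pos
  set z := Tc.transpose.mulVec d with hz_def
  set c := r * dotProduct d ρ with hc
  set S := Finset.univ.filter fun i => z i ≠ 0 with hS_def
  have hzS : ∀ i ∈ S, z i ≠ 0 := fun i hi => (Finset.mem_filter.1 hi).2
  have hsumS : ∀ ω, dotProduct d (Tc.mulVec fun i => e i ω) = ∑ i ∈ S, z i * e i ω := by
    intro ω
    rw [Matrix.dotProduct_mulVec, ← Matrix.mulVec_transpose, ← hz_def]
    refine (Finset.sum_filter_of_ne fun i _ h => ?_).symm
    exact left_ne_zero_of_mul h
  have hgcdS : S.gcd z = 1 := by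
    rw [← hgcd]
    exact Finset.gcd_eq_gcd_filter_ne_zero.symm
  have hsqS : ∑ i, (z i : ℝ) ^ 2 = ∑ i ∈ S, (z i : ℝ) ^ 2 := by
    refine (Finset.sum_filter_of_ne fun i _ h => ?_).symm
    intro h0
    rw [h0] at h
    simp at h
  simp only [hsumS] at hover
  rw [residualCovariance_quadratic, ← hz_def, hsqS]
  rw [norm_realVec_sq, hsqS] at hsm
  refine ⟨fun ω => cmod (c + ∑ i ∈ S, z i * e i ω) q, fun ω => ?_, ?_⟩
  · rw [filterCiphertext_lweEncrypt r s Pρ ρ _ d hd, hsumS]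
  have hmY : Measurable fun ω => c + ∑ i ∈ S, z i * e i ω := by fun_prop
  have hmX : Measurable fun ω => cmod (c + ∑ i ∈ S, z i * e i ω) q :=
    (Measurable.of_discrete (f := fun y => cmod y q)).comp hmY
  set p := P.real {ω | c + ∑ i ∈ S, z i * e i ω ∉ ZqSet q} with hp_def
  have hp0 : 0 ≤ p := measureReal_nonneg
  have hK : 0 ≤ K := by
    by_contra! h
    have := mul_neg_of_neg_of_pos h hε
    linarith
  have hC : K / overflowConst * ε + K * ε + 6 * Real.exp 3 * ε
      = (K / overflowConst + K + 6 * Real.exp 3) * ε := by ring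
  have hpκ : p / overflowConst ≤ K / overflowConst * ε := by
    rw [div_mul_eq_mul_div]
    exact div_le_div_of_nonneg_right hover hκ.le
  have h3ε : 0 ≤ 6 * Real.exp 3 * ε := by positivity
  have hKκ : 0 ≤ K / overflowConst * ε := by positivity
  have he_eq : ∀ i, ∀ x ∈ zqFinset q, P.real {ω | e i ω = x}
      = Real.exp (-(x : ℝ) ^ 2 / (2 * σ ^ 2)) / zqGaussSum σ q := by
    intro i x hx
    have h1 : P.real {ω | e i ω = x} = discreteNormal (ZqSet q) 0 (σ ^ 2) x := congrFun (he i) x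
    rw [h1, discreteNormal_ZqSet _ _ hx]
    simp only [sub_zero, zqGaussSum]
  have he_le : ∀ i (x : ℤ), P.real {ω | e i ω = x}
      ≤ Real.exp (-(x : ℝ) ^ 2 / (2 * σ ^ 2)) / zqGaussSum σ q := by
    intro i x
    by_cases hx : x ∈ zqFinset q
    · exact (he_eq i x hx).le
    · have h1 : P.real {ω | e i ω = x} = discreteNormal (ZqSet q) 0 (σ ^ 2) x := congrFun (he i) x
      rw [h1, discreteNormal_of_notMem _ _ hx]
      exact div_nonneg (Real.exp_pos _).le (zqGaussSum_pos σ hq).le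
  have hSne : S.Nonempty := by
    rw [Finset.nonempty_iff_ne_empty]
    intro h
    rw [h, Finset.gcd_empty] at hgcdS
    exact zero_ne_one hgcdS
  rw [← hC]
  -- The overflow argument needs two non-zero coefficients; a single one is ±1 because the gcd is 1.
  rcases hSne.exists_eq_singleton_or_nontrivial with ⟨i, hSi⟩ | hSnt
  · rw [hSi, Finset.gcd_singleton, ← Int.abs_eq_normalize] at hgcdS
    have hz1 : (z i : ℝ) ^ 2 = 1 := by
      have : |(z i : ℝ)| = 1 := by exact_mod_cast hgcdS
      rw [← sq_abs, this, one_pow]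
    have h := statDist_le_of_one_dim hm hq he_le hgcdS c i
    simp only [hp_def, hSi, Finset.sum_singleton] at hover ⊢
    rw [hz1, mul_one]
    linarith
  · have hsmooth := two_mul_exp_smoothingParameter_le hL hε hε1
    have hs2 : 2 ≤ ∑ i ∈ S, (z i : ℝ) ^ 2 := by
      have h1 : ∀ i ∈ S, (1 : ℝ) ≤ (z i : ℝ) ^ 2 := by
        intro i hiS
        have : (1 : ℤ) ≤ (z i) ^ 2 := by
          have := sq_pos_of_ne_zero (hzS i hiS)
          omega
        exact_mod_cast this
      have h2 := Finset.card_nsmul_le_sum S _ _ h1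
      have h3 : 2 ≤ S.card := Finset.one_lt_card_iff_nontrivial.2 hSnt
      have h4 : (2 : ℝ) ≤ S.card := by exact_mod_cast h3
      rw [nsmul_eq_mul, mul_one] at h2
      linarith
    have hσ2 := half_le_of_smoothing hs2 hε1 hsmooth hsm hσ
    have hu := exp_neg_le_half_sq (by linarith) hsmooth hsm
    -- If p is not small, the trivial bound 1 ≤ p/κ, with κ the constant `overflowConst`, is enough.
    by_cases hpc : overflowConst ≤ p
    · have h1 := statDist_massFunction_le_one (P := P) hmX hq (fun ω => cmod_mem _ hq) c
        (σ ^ 2 * ∑ i ∈ S, (z i : ℝ) ^ 2)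
      have h2 : 1 ≤ p / overflowConst := (one_le_div hκ).2 hpc
      linarith
    rw [not_le] at hpc
    rcases Nat.lt_or_ge q 2 with hq1 | hq2
    -- For q = 1 the target is a point mass, so the pointwise bound holds with δ = 0.
    · obtain rfl : q = 1 := by omega
      have h1 := statDist_cmod_le (P := P) hmY hq c (σ ^ 2 * ∑ i ∈ S, (z i : ℝ) ^ 2)
        (le_refl (0 : ℝ)) fun x hx => by
          have h2 : zqFinset 1 = {x} := by
            refine (Finset.card_eq_one.1 (card_zqFinset 1)).elim fun y hy => ?_
            rw [hy, Finset.mem_singleton] at hx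
            rw [hx, hy]
          have h3 := sum_discreteNormal_ZqSet hq (c : ℝ) (σ ^ 2 * ∑ i ∈ S, (z i : ℝ) ^ 2)
          rw [h2, Finset.sum_singleton] at h3
          rw [h3, add_zero, one_mul]
          exact measureReal_le_one
      linarith
    · have h1 := statDist_le_of_nontrivial hm hi hσ2 hq2 he_eq he_le z c hSnt hzS hgcdS hε hε1 hu hpc
      linarith
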